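/- Identify $\mathbb{R}^2$ with $\mathbb{C}$ and $\mathbb{Z}^2$ with $\mathbb{Z}+i\mathbb{Z}$. Definitions. A curve is a nonempty finite or infinite sequence of consecutive oriented segments $C_k=[x_k,x_k+\varepsilon_k]$ with $x_k\in\mathbb{Z}+i\mathbb{Z}$, $\varepsilon_k\in\{1,-1,i,-i\}$, $x_k+\varepsilon_k=x_{k+1}$ and $\varepsilon_{k+1}=i^{a_k}\varepsilon_k$ with $a_k=\pm1$, rounded at its vertices; it is complete if it is indexed by $\mathbb{Z}$. It is self-avoiding if no nonoriented interval supports two of its segments, and two curves are disjoint if no nonoriented interval supports a segment of each. All sets of curves below consist of pairwise disjoint self-avoiding curves and are coherently oriented: at all points $x+iy$ of one parity of $x+y$ the horizontal segments go out and the vertical ones come in, and at all points of the other parity the vertical segments go out and the horizontal ones come in. A covering is such a set of complete curves for which each interval $[z,z+\varepsilon]$, $z\in\mathbb{Z}+i\mathbb{Z}$, $\varepsilon\in\{1,i\}$, is the support of exactly one segment of one curve. For a sequence of signs $S=(s_1,\dots,s_m)$, let $\overline S=(-s_m,\dots,-s_1)$. The empty sequence is the $0$-folding sequence, and the $(n+1)$-folding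 sequences are the sequences $(\overline S,\pm1,S)$ with $S$ an $n$-folding sequence. A complete folding curve is a complete curve such that each finite block of consecutive terms of its sequence $(a_k)_{k\in\mathbb{Z}}$ is a block of consecutive terms of an $n$-folding sequence for some $n$. For such a sequence let $F_j$ be the set of $h\in\mathbb{Z}$ such that the signs $a_{h+2^{j+1}m}$, $m\in\mathbb{Z}$, alternate, and let $E_n=\mathbb{Z}\setminus\bigcup_{j<n}F_j$. For a set $\mathcal{C}$ of complete folding curves, $E_n(\mathcal{C})$ is the set of the points $x_{k+1}$ for which $k\in E_n$, for the curves of $\mathcal{C}$ (the vertices that remain after $n$ derivations, each of which replaces pairs of consecutive segments by single segments). Write $\mathcal{F}\cong\mathcal{B}$ if $\mathcal{F}$ and $\mathcal{B}$ differ by a translation. Write $\mathcal{B}<\mathcal{C}$ if $\mathcal{B}\neq\mathcal{C}$, each curve of $\mathcal{B}$ is contained in a curve of $\mathcal{C}$, and any consecutive segments of a curve of $\mathcal{C}$ which belong to curves of $\mathcal{B}$ are consecutive in one of them. A covering $\mathcal{C}$ satisfies the local isomorphism property if for each bounded $\mathcal{B}<\mathcal{C}$ there is $r$ such that each ball of radius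 $r$ contains some $\mathcal{F}<\mathcal{C}$ with $\mathcal{F}\cong\mathcal{B}$. For $s>0$ and $z\in\mathbb{C}$ let $\Sigma_s(z)=\{z+x+iy\mid x,y\in[0,s]\}$. The density of $\mathcal{B}$ in $\mathcal{C}$ is the real number $d\ge 0$ if for each $\varepsilon>0$ there is $r>0$ such that, for all real $s\geq r$ and all $z\in\mathbb{C}$, $$s^2d(1-\varepsilon)<\left|\{\mathcal{F}<\mathcal{C}\mid\mathcal{F}\cong\mathcal{B},\ \mathcal{F}\subset\Sigma_s(z)\}\right|<s^2d(1+\varepsilon).$$ Theorem 3. Let $\mathcal{C}$ be a covering by complete folding curves which satisfies the local isomorphism property, and let $\mathcal{B}<\mathcal{C}$ be a nonempty bounded set of curves. Then $\mathcal{B}$ has a density $d$ in $\mathcal{C}$, it is unique, and $d>0$. Moreover there is an integer $n\geq0$ such that some $\mathcal{A}<\mathcal{C}$ with $\mathcal{A}\cong\mathcal{B}$ has no vertex (endpoint of a segment) in $E_{2n+1}(\mathcal{C})$, and for the smallest such $n$ we have $d\geq 1/2^{2n+2}$. -/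

import Mathlib

namespace PaperFolding

/-- The imaginary unit `i`, as a unit of `ℤ + iℤ`. The group of units of `ℤ + iℤ` is
`{1, -1, i, -i}`. -/
def iUnit : GaussianIntˣ where
  val := ⟨0, 1⟩
  inv := ⟨0, -1⟩
  val_inv := by decide
  inv_val := by decide

/-- An oriented segment `[x, x + ε]` with `x ∈ ℤ + iℤ` and `ε ∈ {1, -1, i, -i}`. -/
@[ext]
structure Seg where
  /-- the initial point `x` -/
  init : GaussianInt
  /-- the direction `ε` -/
  dir : GaussianIntˣ

namespace Seg

/-- The terminal point `x + ε`. -/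
def term (A : Seg) : GaussianInt := A.init + (A.dir : GaussianInt)

/-- The nonoriented interval underlying a segment, given by its two endpoints. -/
def edge (A : Seg) : Sym2 GaussianInt := s(A.init, A.term)

/-- The set of points of the complex plane that lie on the segment. -/
def support (A : Seg) : Set ℂ :=
  segment ℝ (GaussianInt.toComplex A.init) (GaussianInt.toComplex A.term)

def IsHorizontal (A : Seg) : Prop := A.dir = 1 ∨ A.dir = -1

def IsVertical (A : Seg) : Prop := A.dir = iUnit ∨ A.dir = -iUnit

/-- The image of a segment under the translation `v ↦ u + v`. -/
def translate (u : GaussianInt) (A : Seg) : Seg := ⟨u + A.init, A.dir⟩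

end Seg

/-- A curve: a sequence of oriented segments, indexed by a nonempty interval of `ℤ` (finite or
infinite), each starting where the previous one ends and making a turn `i` or `i⁻¹` with it. -/
structure Curve where
  idx : Set ℤ
  idx_nonempty : idx.Nonempty
  idx_ordConnected : idx.OrdConnected
  seg : idx → Seg
  term_eq_init : ∀ k l : idx, (l : ℤ) = k + 1 → (seg k).term = (seg l).init
  turns : ∀ k l : idx, (l : ℤ) = k + 1 →
    ∃ a : ℤˣ, (seg l).dir = iUnit ^ (a : ℤ) * (seg k).dir

namespace Curve

/-- The set of segments of a curve. -/
def segs (c : Curve) : Set Seg := Set.range c.seg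

/-- A complete curve is indexed by the whole of `ℤ`. -/
def IsComplete (c : Curve) : Prop := c.idx = Set.univ

/-- The curve turns according to the sequence `a` of signs: `a k` is the turn between the
segments with indices `k` and `k + 1`. -/
def IsAssociatedTo (c : Curve) (a : ℤ → ℤˣ) : Prop :=
  ∀ k l : c.idx, (l : ℤ) = k + 1 → (c.seg l).dir = iUnit ^ (a k : ℤ) * (c.seg k).dir

/-- `A` and `B` are consecutive segments of `c`, in this order. -/
def Consecutive (c : Curve) (A B : Seg) : Prop :=
  ∃ k l : c.idx, (l : ℤ) = k + 1 ∧ c.seg k = A ∧ c.seg l = B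

/-- `c` is contained in `d`, that is, `c` is up to a shift of the indices the restriction of `d`
to an interval of indices. -/
def IsContainedIn (c d : Curve) : Prop :=
  ∃ m : ℤ, ∀ k : c.idx, ∃ l : d.idx, (l : ℤ) = k + m ∧ d.seg l = c.seg k

/-- A curve, rounded at its vertices, is self-avoiding. As all turns are right angles, two
passages of rounded curves through a vertex never meet unless they use a common edge. So
this means that no nonoriented interval is used twice. -/
def IsSelfAvoiding (c : Curve) : Prop :=
  Function.Injective fun k : c.idx => (c.seg k).edge

/-- Two rounded curves are disjoint: no nonoriented interval is used by both. -/
def Disjoint (c d : Curve) : Prop :=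
  ∀ A ∈ c.segs, ∀ B ∈ d.segs, A.edge ≠ B.edge

/-- The image of a curve under the translation `v ↦ u + v`. -/
def translate (u : GaussianInt) (c : Curve) : Curve where
  idx := c.idx
  idx_nonempty := c.idx_nonempty
  idx_ordConnected := c.idx_ordConnected
  seg k := (c.seg k).translate u
  term_eq_init k l h := by
    have := c.term_eq_init k l h
    simp only [Seg.term, Seg.translate] at this ⊢
    rw [add_assoc, this]
  turns k l h := c.turns k l h

end Curve

/-- The segments of the curves that belong to `C`. -/
def segsOf (C : Set Curve) : Set Seg := {A | ∃ c ∈ C, A ∈ c.segs}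

/-- The vertices of `C`: the endpoints of its segments. -/
def verticesOf (C : Set Curve) : Set GaussianInt :=
  {z | ∃ A ∈ segsOf C, z = A.init ∨ z = A.term}

/-- The points of the complex plane that lie on the segments of `C`. -/
def supportOf (C : Set Curve) : Set ℂ := {p | ∃ A ∈ segsOf C, p ∈ A.support}

/-- At `z`, horizontal segments of `C` go out and vertical segments of `C` come in. -/
def HorizontalOut (C : Set Curve) (z : GaussianInt) : Prop :=
  ∀ A ∈ segsOf C, (A.init = z → A.IsHorizontal) ∧ (A.term = z → A.IsVertical)

/-- At `z`, vertical segments of `C` go out and horizontal segments of `C` come in. -/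
def VerticalOut (C : Set Curve) (z : GaussianInt) : Prop :=
  ∀ A ∈ segsOf C, (A.init = z → A.IsVertical) ∧ (A.term = z → A.IsHorizontal)

/-- One of the properties `HorizontalOut`, `VerticalOut` holds at all even points `x + iy`
(`x + y` even), and the other one at all odd points. -/
def IsCoherentlyOriented (C : Set Curve) : Prop :=
  (∀ z : GaussianInt,
    (Even (z.re + z.im) → HorizontalOut C z) ∧ (Odd (z.re + z.im) → VerticalOut C z)) ∨
  (∀ z : GaussianInt,
    (Even (z.re + z.im) → VerticalOut C z) ∧ (Odd (z.re + z.im) → HorizontalOut C z))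

/-- The sets of curves that are considered: sets of pairwise disjoint self-avoiding curves with
coherent orientations. -/
structure IsCurveSystem (C : Set Curve) : Prop where
  selfAvoiding : ∀ c ∈ C, c.IsSelfAvoiding
  disjoint : ∀ c ∈ C, ∀ d ∈ C, c ≠ d → c.Disjoint d
  oriented : IsCoherentlyOriented C

/-- A covering: a system of complete curves such that each nonoriented interval `[z, z + ε]`,
with `z ∈ ℤ + iℤ` and `ε ∈ {1, i}`, is the support of exactly one segment of one curve. -/
structure IsCovering (C : Set Curve) : Prop where
  system : IsCurveSystem C
  complete : ∀ c ∈ C, c.IsComplete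
  covers : ∀ z : GaussianInt, ∀ ε : GaussianIntˣ, ε = 1 ∨ ε = iUnit →
    ∃! p : (c : Curve) × c.idx, p.1 ∈ C ∧ (p.1.seg p.2).edge = s(z, z + (ε : GaussianInt))

/-- The `n`-folding sequences, of length `2 ^ n - 1`. The first fold of the strip gives the
middle term; the other folds give a sequence `S` on one half of the strip and, on the other half,
the sequence that is obtained from `S` by reversing the order and changing the signs. -/
inductive IsFoldingSeq : ℕ → List ℤˣ → Prop
  | zero : IsFoldingSeq 0 []
  | succ (n : ℕ) (S : List ℤˣ) (ε : ℤˣ) (h : IsFoldingSeq n S) :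
      IsFoldingSeq (n + 1) ((S.reverse.map fun x => -x) ++ ε :: S)

/-- A complete folding sequence: each block `(a (k + 1), …, a (k + l))` of consecutive terms
is a block of consecutive terms of an `n`-folding sequence for some `n`. -/
def IsCompleteFoldingSeq (a : ℤ → ℤˣ) : Prop :=
  ∀ (k : ℤ) (l : ℕ), ∃ (n : ℕ) (S : List ℤˣ), IsFoldingSeq n S ∧
    (List.ofFn fun j : Fin l => a (k + 1 + (j : ℕ))) <:+: S

/-- A complete folding curve. -/
def Curve.IsCompleteFolding (c : Curve) : Prop :=
  c.IsComplete ∧ ∃ a : ℤ → ℤˣ, IsCompleteFoldingSeq a ∧ c.IsAssociatedTo a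

/-- The image of a set of curves under the translation `v ↦ u + v`. -/
def translateSet (u : GaussianInt) (C : Set Curve) : Set Curve := Curve.translate u '' C

/-- `C ≅ D`: some translation maps `C` onto `D`. -/
def IsCopy (C D : Set Curve) : Prop := ∃ u : GaussianInt, translateSet u C = D

/-- `C < D`: `C ≠ D`, each curve of `C` is contained in a curve of `D`, and any consecutive
segments of a curve of `D` that belong to curves of `C` are consecutive in one of them. -/
structure Below (C D : Set Curve) : Prop where
  ne : C ≠ D
  contained : ∀ c ∈ C, ∃ d ∈ D, c.IsContainedIn d
  consecutive : ∀ d ∈ D, ∀ A B : Seg, d.Consecutive A B → A ∈ segsOf C → B ∈ segsOf C →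
    ∃ c ∈ C, c.Consecutive A B

/-- A set of curves is bounded. -/
def IsBoundedSystem (B : Set Curve) : Prop := Bornology.IsBounded (supportOf B)

/-- The local isomorphism property: for each bounded `B < C` there is a radius `r` such that each
ball of radius `r` contains some `F < C` with `F ≅ B`. -/
def LocalIsomorphismProperty (C : Set Curve) : Prop :=
  ∀ B : Set Curve, IsCurveSystem B → IsBoundedSystem B → Below B C →
    ∃ r : ℝ, ∀ z : ℂ, ∃ F : Set Curve,
      Below F C ∧ IsCopy F B ∧ supportOf F ⊆ Metric.closedBall z r

/-- The square `Σ_s(z) = {z + x + iy | x, y ∈ [0, s]}`. -/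
def square (s : ℝ) (z : ℂ) : Set ℂ :=
  {p | ∃ x ∈ Set.Icc (0 : ℝ) s, ∃ y ∈ Set.Icc (0 : ℝ) s, p = z + x + Complex.I * y}

/-- The set of copies of `B` in `C` that are contained in the square `Σ_s(z)`. -/
def copiesIn (B C : Set Curve) (s : ℝ) (z : ℂ) : Set (Set Curve) :=
  {F | Below F C ∧ IsCopy F B ∧ supportOf F ⊆ square s z}

/-- The density of `B` in `C` is `d`. -/
def HasDensity (B C : Set Curve) (d : ℝ) : Prop :=
  0 ≤ d ∧ ∀ ε : ℝ, 0 < ε → ∃ r : ℝ, 0 < r ∧ ∀ s : ℝ, r ≤ s → ∀ z : ℂ,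
    s ^ 2 * d * (1 - ε) < ((copiesIn B C s z).ncard : ℝ) ∧
    ((copiesIn B C s z).ncard : ℝ) < s ^ 2 * d * (1 + ε)

/-- For a complete folding sequence `a`, the set `F_j` of the positions that disappear when the
`(j + 1)`-st derivation is applied: the class modulo `2 ^ (j + 1)` along which the signs
alternate. -/
def seqF (a : ℤ → ℤˣ) (j : ℕ) : Set ℤ :=
  {h | ∀ m : ℤ, a (h + (m + 1) * 2 ^ (j + 1)) = -a (h + m * 2 ^ (j + 1))}

/-- The set `E_n` of the positions that are left after `n` derivations. -/
def seqE (a : ℤ → ℤˣ) (n : ℕ) : Set ℤ := {h | ∀ j < n, h ∉ seqF a j}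

/-- The set `E_n(C)` of the vertices of `C` that are still vertices of the `n`-th derivative
of `C`. The vertex at position `k` of a curve is the one between the segments `k` and `k + 1`. -/
def vertexE (C : Set Curve) (n : ℕ) : Set GaussianInt :=
  {z | ∃ c ∈ C, ∃ a : ℤ → ℤˣ, c.IsAssociatedTo a ∧
    ∃ k : c.idx, (k : ℤ) ∈ seqE a n ∧ z = (c.seg k).term}

end PaperFolding

open PaperFolding

namespace PaperFolding

/-! After a shift of the indices, a complete folding sequence has on any prescribed number of levels
the Toeplitz form `α (2 ^ j * (2 * q + 1)) = σ j * (-1) ^ q`, and the positions left after `n`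
derivations are the multiples of `2 ^ n`. A derivation replaces two steps `ε`, `i ^ (±1) * ε` by one
step and divides by `1 + i`. By induction the hierarchy passes from time to the plane: the vertices
of a curve that survive `n` derivations are those congruent to a base point `z` modulo `(1 + i) ^
n`, and the turn at `z + (1 + i) ^ n * w`, `w` odd, is a sign of the level times `(-1) ^ w.im`. It
depends on the point and not on the time (`IsWalk.pow_dvd_iff`, `IsWalk.exists_sign`).

All curves of the covering share one such hierarchy (`IsCovering.exists_isHierarchical`). Indeed, a
folding curve `e` of the covering visits twice every point of arbitrarily large diamonds
(`IsWalk.exists_diamond_double`), where it uses all the edges and leaves no room for another curve.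
Local isomorphism puts a copy of two long blocks, one of `c` and one of `e`, in such a diamond,
hence inside `e`. Long blocks determine the hierarchy (`Curve.IsHierarchical.compare`), so those of
`c` and `e` agree.

Therefore, away from the vertices of level `N`, the covering is invariant under multiples of `(1 +
i) ^ (N + 1)`. For `N = 2 * n + 1`, the shifts that give copies of `B` without vertex in `E_N` form
a set with period `2 ^ (n + 1)`, of density `δ n`. Every other copy has a vertex in one class modulo
`(1 + i) ^ N`, so these copies contribute at most `W / 4 ^ n` per unit area in the limit, where `W`
is the number of vertices of `B`. Squeezing gives the density `sup δ n`
(`IsCovering.exists_count_bounds`, `exists_uniform_density`).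

If some copy avoids `E_N`, each period square contains a good shift, so `δ n ≥ 1 / 2 ^ (2 * n + 2)`.
Such an `n` exists because the points of `E_N` are far apart for large `N`: two copies at bounded
distance without common vertex cannot both meet it (`IsCovering.exists_copy_disjoint`). -/

/-! ### Toeplitz structure of folding sequences -/

theorem neg_one_zpow_eq_of_even_sub {p q : ℤ} (h : Even (p - q)) :
    (-1 : ℤˣ) ^ p = (-1) ^ q := by
  obtain ⟨r, hr⟩ := h
  have : p = q + 2 * r := by omega
  rw [this, zpow_add, zpow_mul]
  simp

theorem neg_one_zpow_eq_neg_of_odd_sub {p q : ℤ} (h : Odd (p - q)) :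
    (-1 : ℤˣ) ^ p = -(-1) ^ q := by
  obtain ⟨r, hr⟩ := h
  have : p = q + 2 * r + 1 := by omega
  rw [this, zpow_add, zpow_add, zpow_mul]
  simp

/-- The term of index `2 ^ j * (2 * q + 1)` is `σ j * (-1) ^ q`, for `j < N`. -/
def IsToeplitz (N : ℕ) (σ : ℕ → ℤˣ) (α : ℤ → ℤˣ) : Prop :=
  ∀ j < N, ∀ q : ℤ, α (2 ^ j * (2 * q + 1)) = σ j * (-1) ^ q

theorem IsFoldingSeq.length_eq {n : ℕ} {S : List ℤˣ} (h : IsFoldingSeq n S) :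
    S.length + 1 = 2 ^ n := by
  induction h with
  | zero => rfl
  | succ n S ε h ih => simp; omega

theorem pow_two_mul_odd_unique {j j' : ℕ} {q q' : ℤ}
    (h : (2 : ℤ) ^ j * (2 * q + 1) = 2 ^ j' * (2 * q' + 1)) : j = j' ∧ q = q' := by
  wlog hj : j ≤ j' generalizing j j' q q'
  · have := this h.symm (by omega)
    omega
  obtain ⟨d, rfl⟩ := Nat.exists_eq_add_of_le hj
  rw [pow_add, mul_assoc] at h
  have h2 := mul_left_cancel₀ (by positivity) h
  cases d with
  | zero => simp at h2; simp; omega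
  | succ d =>
    rw [pow_succ] at h2
    have : (2 : ℤ) ∣ 1 := ⟨2 ^ d * (2 * q' + 1) - q, by linarith⟩
    omega

/-- Positions are counted from 1. In `(S̄, ε, S)` the left half reads `S` at `2 ^ n - p` with the
sign changed, the right half reads `S` at `p - 2 ^ n`. Both operations preserve the level of `p` and
have the same effect on the signs. -/
theorem IsFoldingSeq.exists_toeplitz {n : ℕ} {S : List ℤˣ} (h : IsFoldingSeq n S) :
    ∃ σ : ℕ → ℤˣ, ∀ (i j : ℕ) (q : ℤ) (hi : i < S.length),
      (i : ℤ) + 1 = 2 ^ j * (2 * q + 1) → S[i] = σ j * (-1) ^ q := by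
  induction h with
  | zero => exact ⟨fun _ => 1, fun i j q hi => by simp at hi⟩
  | succ n S ε h ih =>
    obtain ⟨σ, hσ⟩ := ih
    have hl := h.length_eq
    have hl' : ((S.length : ℕ) : ℤ) + 1 = 2 ^ n := by exact_mod_cast hl
    -- The middle term is alone on level `n`. Level `n - 1` had one term in `S`; the shift by `2 ^
    -- n` changes the parity of `q` there, hence the sign, and only there.
    refine ⟨fun j => if j = n then ε else if j + 1 = n then -σ j else σ j, ?_⟩
    intro i j q hi hij
    have hjn : ∀ e : ℤ, (i : ℤ) + 1 = 2 ^ n * e → ∃ d : ℕ, j = n + d := by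
      intro e he
      by_contra hcon
      have hlt : j < n := by
        by_contra h'
        exact hcon ⟨j - n, by omega⟩
      obtain ⟨d, rfl⟩ := Nat.exists_eq_add_of_lt hlt
      rw [he, pow_add, pow_add, mul_assoc, mul_assoc] at hij
      have h2 := mul_left_cancel₀ (by positivity) hij
      have : (2 : ℤ) ∣ 1 := ⟨2 ^ d * e - q, by linarith⟩
      omega
    simp only [List.length_append, List.length_map, List.length_reverse, List.length_cons] at hi
    have hpos : (0 : ℤ) < 2 ^ n := by positivity
    rcases lt_trichotomy i S.length with hlt | heq | hgt
    · rw [List.getElem_append_left (by simpa using hlt)]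
      simp only [List.getElem_map, List.getElem_reverse]
      have hjlt : j < n := by
        by_contra hcon
        have h1 : (2 : ℤ) ^ n ∣ (i : ℤ) + 1 := by
          rw [hij]; exact Dvd.dvd.mul_right (pow_dvd_pow _ (by omega)) _
        have := Int.le_of_dvd (by omega) h1
        omega
      obtain ⟨d, rfl⟩ := Nat.exists_eq_add_of_lt hjlt
      have hq : ((S.length - 1 - i : ℕ) : ℤ) + 1 = 2 ^ j * (2 * (2 ^ d - q - 1) + 1) := by
        have : ((S.length - 1 - i : ℕ) : ℤ) + 1 = S.length - i := by omega
        rw [this]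
        have : (S.length : ℤ) - i = 2 ^ (j + d + 1) - (i + 1) := by omega
        rw [this, hij]; ring
      rw [hσ _ j _ (by omega) hq, if_neg (by omega)]
      cases d with
      | zero =>
        rw [if_pos (by omega), neg_one_zpow_eq_of_even_sub (p := 2 ^ 0 - q - 1) (q := q)]
        · simp
        · exact ⟨-q, by ring⟩
      | succ d =>
        rw [if_neg (by omega), neg_one_zpow_eq_neg_of_odd_sub (p := 2 ^ (d + 1) - q - 1) (q := q)]
        · simp
        · exact ⟨2 ^ d - q - 1, by ring⟩
    · subst heq
      rw [List.getElem_append_right (by simp)]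
      have : 2 ^ n * (2 * 0 + 1) = (2 : ℤ) ^ j * (2 * q + 1) := by rw [← hij, hl']; ring
      obtain ⟨rfl, rfl⟩ := pow_two_mul_odd_unique this
      simp
    · rw [List.getElem_append_right (by simp; omega)]
      simp only [List.length_map, List.length_reverse]
      rw [List.getElem_cons, dif_neg (by omega)]
      have hjlt : j < n := by
        by_contra hcon
        have h1 : (2 : ℤ) ^ n ∣ (i : ℤ) + 1 := by
          rw [hij]; exact Dvd.dvd.mul_right (pow_dvd_pow _ (by omega)) _
        have h2 : (2 : ℤ) ^ n ∣ (i : ℤ) + 1 - 2 ^ n := dvd_sub h1 dvd_rfl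
        have := Int.le_of_dvd (by omega) h2
        omega
      obtain ⟨d, rfl⟩ := Nat.exists_eq_add_of_lt hjlt
      have hq : ((i - S.length - 1 : ℕ) : ℤ) + 1 = 2 ^ j * (2 * (q - 2 ^ d) + 1) := by
        have : ((i - S.length - 1 : ℕ) : ℤ) + 1 = i + 1 - 2 ^ (j + d + 1) := by omega
        rw [this, hij]; ring
      rw [hσ _ j _ (by omega) hq, if_neg (by omega)]
      cases d with
      | zero =>
        rw [if_pos (by omega), neg_one_zpow_eq_neg_of_odd_sub (p := q - 2 ^ 0) (q := q)]
        · simp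
        · exact ⟨-1, by ring⟩
      | succ d =>
        rw [if_neg (by omega), neg_one_zpow_eq_of_even_sub (p := q - 2 ^ (d + 1)) (q := q)]
        exact ⟨-2 ^ d, by ring⟩

theorem IsCompleteFoldingSeq.exists_toeplitz_block {a : ℤ → ℤˣ} (h : IsCompleteFoldingSeq a)
    (l : ℕ) : ∃ (τ : ℤ) (σ : ℕ → ℤˣ), ∀ k : ℤ, |k| ≤ l → ∀ (j : ℕ) (q : ℤ),
      k + τ = 2 ^ j * (2 * q + 1) → a k = σ j * (-1) ^ q := by
  -- The block with indices from `-l` to `l`.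
  obtain ⟨n, S, hS, pre, post, hpre⟩ := h (-l - 1) (2 * l + 1)
  obtain ⟨σ, hσ⟩ := hS.exists_toeplitz
  refine ⟨pre.length + l + 1, σ, ?_⟩
  intro k hk j q hkq
  rw [abs_le] at hk
  obtain ⟨m, hm⟩ : ∃ m : ℕ, k = -l + m := ⟨(k + l).toNat, by omega⟩
  have hm2 : m < 2 * l + 1 := by omega
  subst hpre
  have := hσ (pre.length + m) j q (by simp; omega) (by push_cast; rw [← hkq, hm]; ring)
  rw [← this, List.getElem_append_left (by simp; omega), List.getElem_append_right (by simp)]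
  simp only [add_tsub_cancel_left, List.getElem_ofFn, hm]
  congr 1
  ring

/-- Pigeonhole: the shift and signs of a block vary with its length, but a term of level less than
`N` depends only on its position modulo `2 ^ (N + 1)` and on `N` signs. One choice of these data
occurs for arbitrarily long blocks. -/
theorem IsCompleteFoldingSeq.exists_toeplitz {a : ℤ → ℤˣ} (h : IsCompleteFoldingSeq a)
    (N : ℕ) : ∃ (τ : ℤ) (σ : ℕ → ℤˣ), IsToeplitz N σ fun t => a (t - τ) := by
  choose τ σ H using h.exists_toeplitz_block
  obtain ⟨⟨T, S⟩, hT⟩ := Finite.exists_infinite_fiber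
    fun l : ℕ => (((τ l : ℤ) : ZMod (2 ^ (N + 1))), fun j : Fin N => σ l j)
  have hT := Set.infinite_coe_iff.mp hT
  obtain ⟨l₀, hl₀⟩ := hT.nonempty
  refine ⟨τ l₀, σ l₀, ?_⟩
  intro j hj q
  obtain ⟨l, hl, hlt⟩ := hT.exists_gt (2 ^ j * (2 * q + 1) - τ l₀).natAbs
  simp only [Set.mem_preimage, Set.mem_singleton_iff, Prod.mk.injEq] at hl hl₀
  have h1 : ((τ l₀ : ℤ) : ZMod (2 ^ (N + 1))) = (τ l : ℤ) := hl₀.1.trans hl.1.symm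
  rw [ZMod.intCast_eq_intCast_iff_dvd_sub] at h1
  obtain ⟨e, he⟩ := h1
  have h2 : σ l₀ j = σ l j := congrFun (hl₀.2.trans hl.2.symm) ⟨j, hj⟩
  obtain ⟨d, rfl⟩ := Nat.exists_eq_add_of_lt hj
  change a (2 ^ j * (2 * q + 1) - τ l₀) = _
  rw [H l _ (by rw [Int.abs_eq_natAbs]; exact_mod_cast hlt.le) j (q + 2 ^ (d + 1) * e)]
  · rw [h2, neg_one_zpow_eq_of_even_sub]
    exact ⟨2 ^ d * e, by ring⟩
  · push_cast at he
    rw [show τ l = τ l₀ + 2 ^ (j + d + 1 + 1) * e by linarith]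
    ring

theorem exists_eq_pow_two_mul_odd {n : ℕ} {t : ℤ} (h : ¬ 2 ^ n ∣ t) :
    ∃ j < n, ∃ q : ℤ, t = 2 ^ j * (2 * q + 1) := by
  induction n generalizing t with
  | zero => simp at h
  | succ n ih =>
    rcases Int.even_or_odd' t with ⟨m, rfl | rfl⟩
    · have : ¬ (2 : ℤ) ^ n ∣ m := fun ⟨e, he⟩ => h ⟨e, by rw [he]; ring⟩
      obtain ⟨j, hj, q, rfl⟩ := ih this
      exact ⟨j + 1, by omega, q, by ring⟩
    · exact ⟨0, by omega, m, by ring⟩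

theorem not_pow_two_dvd {j n : ℕ} (h : j < n) (q : ℤ) : ¬ (2 : ℤ) ^ n ∣ 2 ^ j * (2 * q + 1) := by
  obtain ⟨d, rfl⟩ := Nat.exists_eq_add_of_lt h
  rintro ⟨e, he⟩
  rw [add_assoc, pow_add, mul_assoc] at he
  have h2 := mul_left_cancel₀ (by positivity) he
  have : (2 : ℤ) ∣ 1 := ⟨2 ^ d * e - q, by rw [pow_succ] at h2; linarith⟩
  omega

/-- Along a class modulo `2 ^ (j + 1)` the signs are constant if the level is less than `j` and
alternate if it is `j`. The remaining class contains all higher levels; level `j + 1` occupies every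
second place there and itself alternates, which excludes alternation of the class. Hence the need
for `j + 1 < N`. -/
theorem IsToeplitz.mem_seqF_iff {N : ℕ} {σ : ℕ → ℤˣ} {a : ℤ → ℤˣ} {τ : ℤ}
    (h : IsToeplitz N σ fun t => a (t - τ)) {j : ℕ} (hj : j + 1 < N) (k : ℤ) :
    k ∈ seqF a j ↔ ∃ q : ℤ, k + τ = 2 ^ j * (2 * q + 1) := by
  have key : ∀ i < N, ∀ k q : ℤ, k + τ = 2 ^ i * (2 * q + 1) → a k = σ i * (-1) ^ q := by
    intro i hi k q hk
    rw [← h i hi q, ← hk]; simp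
  have hne : ∀ x : ℤˣ, x ≠ -x := by decide
  constructor
  · intro hk
    by_cases hd : (2 : ℤ) ^ (j + 1) ∣ k + τ
    · exfalso
      obtain ⟨e, he⟩ := hd
      have h1 := hk (1 - e)
      have h2 := hk (1 - e + 1)
      rw [h1, neg_neg] at h2
      rw [key (j + 1) hj _ 1 (by linear_combination he),
        key (j + 1) hj _ 0 (by linear_combination he)] at h2
      exact hne _ (h2.symm.trans (by simp))
    · obtain ⟨i, hi, q, hq⟩ := exists_eq_pow_two_mul_odd hd
      rcases Nat.lt_succ_iff_lt_or_eq.mp hi with hi | rfl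
      · exfalso
        have h1 := hk 0
        obtain ⟨d, rfl⟩ := Nat.exists_eq_add_of_lt hi
        rw [key i (by omega) _ (q + 2 ^ (d + 1)) (by linear_combination hq),
          key i (by omega) _ q (by linear_combination hq),
          neg_one_zpow_eq_of_even_sub (p := q + 2 ^ (d + 1)) (q := q) ⟨2 ^ d, by ring⟩] at h1
        exact hne _ h1
      · exact ⟨q, hq⟩
  · rintro ⟨q, hq⟩ m
    rw [key j (by omega) _ (q + m + 1) (by linear_combination hq),
      key j (by omega) _ (q + m) (by linear_combination hq),
      neg_one_zpow_eq_neg_of_odd_sub (p := q + m + 1) (q := q + m) ⟨0, by ring⟩]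
    simp

theorem IsToeplitz.mem_seqE_iff {N : ℕ} {σ : ℕ → ℤˣ} {a : ℤ → ℤˣ} {τ : ℤ}
    (h : IsToeplitz N σ fun t => a (t - τ)) {n : ℕ} (hn : n < N) (k : ℤ) :
    k ∈ seqE a n ↔ (2 : ℤ) ^ n ∣ k + τ := by
  constructor
  · intro hk
    by_contra hd
    obtain ⟨j, hj, hq⟩ := exists_eq_pow_two_mul_odd hd
    exact hk j hj ((h.mem_seqF_iff (by omega) k).mpr hq)
  · intro hd j hj hk
    obtain ⟨q, hq⟩ := (h.mem_seqF_iff (by omega) k).mp hk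
    rw [hq] at hd
    exact not_pow_two_dvd hj q hd

/-- Two Toeplitz sequences which coincide on a long interval have the same hierarchy. -/
theorem IsToeplitz.dvd_sub_of_eqOn {N : ℕ} {σ σ' : ℕ → ℤˣ} {α α' : ℤ → ℤˣ} {m k₀ : ℤ}
    (h : IsToeplitz (N + 1) σ α) (h' : IsToeplitz (N + 1) σ' α')
    (heq : ∀ k : ℤ, k₀ ≤ k → k ≤ k₀ + 2 ^ (N + 3) → α k = α' (k + m)) :
    (2 : ℤ) ^ N ∣ m := by
  have hne : ∀ x : ℤˣ, x ≠ -x := by decide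
  suffices H : ∀ n ≤ N, (2 : ℤ) ^ n ∣ m from H N le_rfl
  intro n
  induction n with
  | zero => simp
  | succ n ih =>
    intro hn
    obtain ⟨e, he⟩ := ih (by omega)
    rcases Int.even_or_odd' e with ⟨f, rfl | rfl⟩
    · exact ⟨f, by rw [he]; ring⟩
    exfalso
    -- positions `k` with `k + m = 2 ^ (n + 1) * odd`
    obtain ⟨q, hq1, hq2⟩ : ∃ q : ℤ, k₀ ≤ 2 ^ (n + 1) * (2 * q + 1) - m ∧
        2 ^ (n + 1) * (2 * q + 1) - m < k₀ + 2 ^ (n + 2) := by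
      have hp : (0 : ℤ) < 2 ^ (n + 2) := by positivity
      refine ⟨-((2 ^ (n + 1) - m - k₀) / 2 ^ (n + 2)), ?_, ?_⟩
      · have := Int.mul_ediv_self_le (x := 2 ^ (n + 1) - m - k₀) (k := 2 ^ (n + 2)) hp.ne'
        linear_combination this
      · have := Int.lt_mul_ediv_self_add (x := 2 ^ (n + 1) - m - k₀) (k := 2 ^ (n + 2)) hp
        linear_combination this
    have hpow : (2 : ℤ) ^ (n + 2) + 2 ^ (n + 2) ≤ 2 ^ (N + 3) := by
      rw [← two_mul, ← pow_succ']
      exact pow_le_pow_right₀ (by norm_num) (by omega)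
    -- If `m` is `2 ^ n` times an odd number, these positions have level `n` for `α` and, after the
    -- shift by `m`, level `n + 1` for `α'`. Advancing by `2 ^ (n + 2)` preserves the sign at level
    -- `n` and changes it at level `n + 1`.
    have e1 := heq (2 ^ (n + 1) * (2 * q + 1) - m) hq1 (by
      have : (0 : ℤ) < 2 ^ (n + 2) := by positivity
      omega)
    have e2 := heq (2 ^ (n + 1) * (2 * q + 1) - m + 2 ^ (n + 2)) (by
      have : (0 : ℤ) < 2 ^ (n + 2) := by positivity
      omega) (by omega)
    rw [show 2 ^ (n + 1) * (2 * q + 1) - m = 2 ^ n * (2 * (2 * q + 1 - f - 1) + 1) by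
      rw [he]; ring, h n (by omega),
      show 2 ^ n * (2 * (2 * q + 1 - f - 1) + 1) + m = 2 ^ (n + 1) * (2 * q + 1) by
        rw [he]; ring, h' (n + 1) (by omega)] at e1
    rw [show 2 ^ (n + 1) * (2 * q + 1) - m + 2 ^ (n + 2) =
        2 ^ n * (2 * (2 * q + 1 - f - 1 + 2) + 1) by
      rw [he]; ring, h n (by omega),
      show 2 ^ n * (2 * (2 * q + 1 - f - 1 + 2) + 1) + m = 2 ^ (n + 1) * (2 * (q + 1) + 1) by
        rw [he]; ring, h' (n + 1) (by omega),
      neg_one_zpow_eq_of_even_sub (p := 2 * q + 1 - f - 1 + 2) (q := 2 * q + 1 - f - 1)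
        ⟨1, by ring⟩, e1,
      neg_one_zpow_eq_neg_of_odd_sub (p := q + 1) (q := q) ⟨0, by ring⟩] at e2
    exact hne _ (e2.trans (by simp))

/-! ### Lattice walks and their derivation -/

/-- The Gaussian integer `1 + i`. -/
def oneAddI : GaussianInt := ⟨1, 1⟩

@[simp] theorem oneAddI_re : oneAddI.re = 1 := rfl
@[simp] theorem oneAddI_im : oneAddI.im = 1 := rfl

@[simp] theorem iUnit_val : ((iUnit : GaussianIntˣ) : GaussianInt) = ⟨0, 1⟩ := rfl
@[simp] theorem iUnit_inv_val : ((iUnit⁻¹ : GaussianIntˣ) : GaussianInt) = ⟨0, -1⟩ := rfl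

theorem oneAddI_ne_zero : oneAddI ≠ 0 := by
  intro h; simpa using congrArg Zsqrtd.re h

theorem oneAddI_dvd_iff (g : GaussianInt) : oneAddI ∣ g ↔ Even (g.re + g.im) := by
  constructor
  · rintro ⟨h, rfl⟩
    exact ⟨h.re, by simp⟩
  · rintro ⟨r, hr⟩
    refine ⟨⟨r, r - g.re⟩, ?_⟩
    ext <;> simp
    omega

theorem oneAddI_sq_dvd {g : GaussianInt} (h : oneAddI ^ 2 ∣ g) : Even g.re ∧ Even g.im := by
  obtain ⟨h, rfl⟩ := h
  exact ⟨⟨-h.im, by simp [pow_two]; ring⟩, ⟨h.re, by simp [pow_two]; ring⟩⟩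

theorem unit_eq (ε : GaussianIntˣ) :
    ε = 1 ∨ ε = -1 ∨ ε = iUnit ∨ ε = -iUnit := by
  have h : ((ε : GaussianInt) * ((ε⁻¹ : GaussianIntˣ) : GaussianInt)) = 1 := by simp
  have h3 : Zsqrtd.norm (ε : GaussianInt) = 1 :=
    (Zsqrtd.norm_eq_one_iff' (by norm_num) _).mpr ε.isUnit
  have h4 : (ε : GaussianInt).re * (ε : GaussianInt).re +
      (ε : GaussianInt).im * (ε : GaussianInt).im = 1 := by
    rw [Zsqrtd.norm_def] at h3; linarith
  obtain ⟨x, hx⟩ : ∃ x, (ε : GaussianInt).re = x := ⟨_, rfl⟩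
  obtain ⟨y, hy⟩ : ∃ y, (ε : GaussianInt).im = y := ⟨_, rfl⟩
  have hx1 : -1 ≤ x := by nlinarith
  have hx2 : x ≤ 1 := by nlinarith
  have hy1 : -1 ≤ y := by nlinarith
  have hy2 : y ≤ 1 := by nlinarith
  rw [hx, hy] at h4
  simp only [Units.ext_iff, Zsqrtd.ext_iff, hx, hy]
  interval_cases x <;> interval_cases y <;> simp_all

/-- The units `1` and `-1`. -/
def IsHor (ε : GaussianIntˣ) : Prop := ε = 1 ∨ ε = -1

instance : DecidablePred IsHor := fun ε => inferInstanceAs (Decidable (ε = 1 ∨ ε = -1))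

theorem isHor_turn (a : ℤˣ) (ε : GaussianIntˣ) : IsHor (iUnit ^ (a : ℤ) * ε) ↔ ¬ IsHor ε := by
  rcases Int.units_eq_one_or a with rfl | rfl <;>
    rcases unit_eq ε with rfl | rfl | rfl | rfl <;> simp [IsHor] <;> decide

theorem not_isHor_iff_odd_im (ε : GaussianIntˣ) : ¬ IsHor ε ↔ Odd (ε : GaussianInt).im := by
  rcases unit_eq ε with rfl | rfl | rfl | rfl <;> simp [IsHor] <;> decide

theorem odd_unit (ε : GaussianIntˣ) : Odd ((ε : GaussianInt).re + (ε : GaussianInt).im) := by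
  rcases unit_eq ε with rfl | rfl | rfl | rfl <;> simp

theorem eq_or_eq_neg_of_isHor_iff {ε ε' : GaussianIntˣ} (h : IsHor ε ↔ IsHor ε') :
    ε = ε' ∨ ε = -ε' := by
  rcases unit_eq ε with rfl | rfl | rfl | rfl <;>
    rcases unit_eq ε' with rfl | rfl | rfl | rfl <;> revert h <;> decide

/-- A walk on the square lattice which visits `y t` at the time `t`, leaves it in the direction
`D t`, and makes there a turn `α t`. -/
structure IsWalk (y : ℤ → GaussianInt) (D : ℤ → GaussianIntˣ) (α : ℤ → ℤˣ) : Prop where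
  step : ∀ t, y (t + 1) = y t + D t
  turn : ∀ t, D (t + 1) = iUnit ^ (α (t + 1) : ℤ) * D t

theorem int_const_of_succ {β : Type*} {f : ℤ → β} (h : ∀ t, f (t + 1) = f t) (t : ℤ) :
    f t = f 0 := by
  induction t using Int.induction_on with
  | zero => rfl
  | succ i ih => rw [h, ih]
  | pred i ih => rw [← ih, ← h]; congr 1; ring

theorem IsWalk.parity {y D α} (h : IsWalk y D α) (t : ℤ) :
    Even ((y t - y 0).re + (y t - y 0).im - t) := by
  have := int_const_of_succ (f := fun t => Even ((y t - y 0).re + (y t - y 0).im - t)) ?_ t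
  · simp only [this]; simp
  · intro t
    have := odd_unit (D t)
    simp only [h.step, Zsqrtd.re_sub, Zsqrtd.re_add, Zsqrtd.im_sub, Zsqrtd.im_add, eq_iff_iff] at *
    rw [show (y t).re + (D t : GaussianInt).re - (y 0).re +
        ((y t).im + (D t : GaussianInt).im - (y 0).im) - (t + 1) =
        ((y t).re - (y 0).re + ((y t).im - (y 0).im) - t) +
        ((D t : GaussianInt).re + (D t : GaussianInt).im - 1) by ring]
    rw [Int.even_add]
    have h2 : Even ((D t : GaussianInt).re + (D t : GaussianInt).im - 1) := this.sub_odd odd_one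
    simp [h2]

theorem IsWalk.even_iff {y D α} (h : IsWalk y D α) (t : ℤ) :
    Even ((y t - y 0).re + (y t - y 0).im) ↔ Even t := by
  have := h.parity t
  rw [Int.even_sub] at this
  exact this

theorem IsWalk.isHor_iff {y D α} (h : IsWalk y D α) (t : ℤ) :
    IsHor (D t) ↔ (Even t ↔ IsHor (D 0)) := by
  have := int_const_of_succ (f := fun t => (IsHor (D t) ↔ (Even t ↔ IsHor (D 0)))) ?_ t
  · simp only [this]; simp
  · intro t
    simp only [h.turn, isHor_turn, Int.even_add_one]
    grind

/-- The factor by which the direction of a derived segment differs from the direction of the first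
of the two segments which it replaces. -/
def derivedFactor (a : ℤˣ) : GaussianIntˣ := if a = 1 then 1 else iUnit⁻¹

theorem one_add_iUnit_zpow (a : ℤˣ) :
    1 + ((iUnit ^ (a : ℤ) : GaussianIntˣ) : GaussianInt) =
      oneAddI * (derivedFactor a : GaussianInt) := by
  rcases Int.units_eq_one_or a with rfl | rfl <;> simp [derivedFactor, oneAddI] <;> rfl

theorem iUnit_zpow_mul_derivedFactor_neg (a : ℤˣ) :
    iUnit ^ (a : ℤ) * derivedFactor (-a) = derivedFactor a := by
  rcases Int.units_eq_one_or a with rfl | rfl <;> simp [derivedFactor]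

/-- The derived walk. -/
theorem IsWalk.exists_derived {y D α} (h : IsWalk y D α) {N : ℕ} {σ : ℕ → ℤˣ}
    (hα : IsToeplitz (N + 1) σ α) :
    ∃ y', IsWalk y' (fun m => D (2 * m) * derivedFactor (α (2 * m + 1))) (fun m => α (2 * m)) ∧
      IsToeplitz N (fun j => σ (j + 1)) (fun m => α (2 * m)) ∧
      (∀ m, y (2 * m) = y 0 + oneAddI * y' m) ∧ y' 0 = 0 := by
  have hdvd : ∀ m, oneAddI ∣ y (2 * m) - y 0 := fun m => by
    rw [oneAddI_dvd_iff, h.even_iff]; simp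
  choose y' hy' using hdvd
  have hy'' : ∀ m, y (2 * m) = y 0 + oneAddI * y' m := fun m => by rw [← hy']; ring
  refine ⟨y', ⟨?_, ?_⟩, ?_, hy'', ?_⟩
  · intro m
    apply mul_left_cancel₀ oneAddI_ne_zero
    have h1 : y (2 * (m + 1)) = y (2 * m) + D (2 * m) *
        (oneAddI * (derivedFactor (α (2 * m + 1)) : GaussianInt)) := by
      rw [← one_add_iUnit_zpow, show 2 * (m + 1) = 2 * m + 1 + 1 by ring, h.step, h.step, h.turn]
      push_cast; ring
    rw [hy'', hy''] at h1
    push_cast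
    linear_combination h1
  · intro m
    -- The odd turns alternate, so the correcting factors of two consecutive derived steps differ by
    -- exactly the turn that is removed between them.
    have h0 : α (2 * (m + 1) + 1) = -α (2 * m + 1) := by
      have e1 := hα 0 (by omega) (m + 1)
      have e2 := hα 0 (by omega) m
      simp only [pow_zero, one_mul] at e1 e2
      rw [e1, e2, neg_one_zpow_eq_neg_of_odd_sub (p := m + 1) (q := m) ⟨0, by ring⟩]
      simp
    rw [h0]
    rw [show D (2 * (m + 1)) = iUnit ^ (α (2 * (m + 1)) : ℤ) *
      (iUnit ^ (α (2 * m + 1) : ℤ) * D (2 * m)) by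
        rw [show 2 * (m + 1) = 2 * m + 1 + 1 by ring, h.turn, h.turn]]
    rw [← iUnit_zpow_mul_derivedFactor_neg (α (2 * m + 1))]
    simp only [mul_assoc, mul_comm, mul_left_comm]
  · intro j hj q
    refine (congrArg α ?_).trans (hα (j + 1) (by omega) q)
    ring
  · have := hy'' 0
    simpa [oneAddI_ne_zero] using this

/-- At odd times the walk is at an odd distance from `y 0`, so `1 + i` does not divide; at even
times one factor `1 + i` and one factor 2 are removed by deriving. -/
theorem IsWalk.pow_dvd_iff {y D α} (h : IsWalk y D α) {N : ℕ} {σ : ℕ → ℤˣ}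
    (hα : IsToeplitz N σ α) {n : ℕ} (hn : n ≤ N) (t : ℤ) :
    oneAddI ^ n ∣ y t - y 0 ↔ (2 : ℤ) ^ n ∣ t := by
  induction n generalizing N σ y D α t with
  | zero => simp
  | succ n ih =>
    obtain ⟨N, rfl⟩ : ∃ M, N = M + 1 := ⟨N - 1, by omega⟩
    obtain ⟨y', h', hα', hy, hy0⟩ := h.exists_derived hα
    rcases Int.even_or_odd' t with ⟨m, rfl | rfl⟩
    · have := ih h' hα' (by omega) m
      rw [hy0, sub_zero] at this
      rw [hy m, add_sub_cancel_left, pow_succ', pow_succ',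
        mul_dvd_mul_iff_left oneAddI_ne_zero, mul_dvd_mul_iff_left (by norm_num), this]
    · constructor
      · intro hd
        have := (oneAddI_dvd_iff _).mp ((Dvd.intro _ (pow_succ' _ _).symm).trans hd)
        rw [h.even_iff] at this
        exact absurd this (by simp)
      · intro hd
        have : (2 : ℤ) ∣ 2 * m + 1 := (Dvd.intro _ (pow_succ' _ _).symm).trans hd
        omega

/-- The alternating sign on the odd Gaussian integers. -/
def altSign (w : GaussianInt) : ℤˣ := (-1) ^ w.im

theorem altSign_eq_of_dvd {w w' : GaussianInt} (h : oneAddI ^ 2 ∣ w - w') :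
    altSign w = altSign w' :=
  neg_one_zpow_eq_of_even_sub (by simpa using (oneAddI_sq_dvd h).2)

/-- The turn is a function of the point alone, which allows different visits and different curves to
be compared. Deriving reduces every level to level 0. -/
theorem IsWalk.exists_sign {y D α} (h : IsWalk y D α) {N : ℕ} {σ : ℕ → ℤˣ}
    (hα : IsToeplitz N σ α) :
    ∃ s : ℕ → ℤˣ, ∀ n < N, ∀ t w, Odd (w.re + w.im) → y t = y 0 + oneAddI ^ n * w →
      α t = s n * altSign w := by
  induction N generalizing σ y D α with
  | zero => exact ⟨fun _ => 1, by simp⟩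
  | succ N ih =>
    obtain ⟨y', h', hα', hy, hy0⟩ := h.exists_derived hα
    obtain ⟨s, hs⟩ := ih h' hα'
    refine ⟨fun n => Nat.casesOn n (σ 0 * altSign (y 1 - y 0)) s, ?_⟩
    intro n hn t w hw ht
    cases n with
    | zero =>
      have hw' : w = y t - y 0 := by rw [ht]; ring
      have hodd : Odd t := by
        rw [← Int.not_even_iff_odd, ← h.even_iff, ← hw', Int.not_even_iff_odd]; exact hw
      obtain ⟨q, rfl⟩ := hodd
      have := hα 0 (by omega) q
      simp only [pow_zero, one_mul] at this
      -- Between two consecutive odd times there are one horizontal and one vertical step, so the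
      -- parity of the imaginary part changes exactly when the Toeplitz sign does.
      have hc := int_const_of_succ
        (f := fun q : ℤ => (-1 : ℤˣ) ^ q * altSign (y (2 * q + 1) - y 0)) ?_ q
      · simp only [mul_zero, zero_add, zpow_zero, one_mul] at hc
        rw [this, hw']
        change _ = σ 0 * altSign (y 1 - y 0) * _
        rw [← hc, mul_assoc, mul_assoc, Int.units_mul_self, mul_one]
      · intro q
        have hne : altSign (y (2 * (q + 1) + 1) - y 0) = -altSign (y (2 * q + 1) - y 0) := by
          apply neg_one_zpow_eq_neg_of_odd_sub
          rw [show 2 * (q + 1) + 1 = 2 * q + 1 + 1 + 1 by ring, h.step, h.step]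
          simp only [Zsqrtd.im_sub, Zsqrtd.im_add]
          have key : Odd ((D (2 * q + 1) : GaussianInt).im +
              (D (2 * q + 1 + 1) : GaussianInt).im) := by
            have ht := isHor_turn (α (2 * q + 1 + 1)) (D (2 * q + 1))
            rw [← h.turn] at ht
            by_cases hh : IsHor (D (2 * q + 1))
            · have e1 : ¬ Odd (D (2 * q + 1) : GaussianInt).im := by
                rw [← not_isHor_iff_odd_im, not_not]; exact hh
              have e2 := (not_isHor_iff_odd_im _).mp (mt ht.mp (not_not.mpr hh))
              exact Even.add_odd (Int.not_odd_iff_even.mp e1) e2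
            · have e1 := (not_isHor_iff_odd_im _).mp hh
              have e2 : ¬ Odd (D (2 * q + 1 + 1) : GaussianInt).im := by
                rw [← not_isHor_iff_odd_im, not_not]; exact ht.mpr hh
              exact Odd.add_even e1 (Int.not_odd_iff_even.mp e2)
          convert key using 1
          ring
        simp only [hne, zpow_add, zpow_one]
        simp
    | succ n =>
      have heven : Even t := by
        rw [← h.even_iff, ← oneAddI_dvd_iff, ht, add_sub_cancel_left, pow_succ', mul_assoc]
        exact dvd_mul_right _ _
      obtain ⟨m, rfl⟩ := heven
      rw [← two_mul] at ht ⊢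
      refine hs n (by omega) m w hw ?_
      rw [hy m] at ht
      rw [hy0, zero_add]
      apply mul_left_cancel₀ oneAddI_ne_zero
      rw [← mul_assoc, ← pow_succ']
      linear_combination ht

/-! ### A finite computation: a point and its four neighbours visited twice -/

/-- The points which a walk visits at least twice. -/
def doublePoints (y : ℤ → GaussianInt) : Set GaussianInt :=
  {v | ∃ t t' : ℤ, t ≠ t' ∧ y t = v ∧ y t' = v}

/-- The turn of index `t` of a Toeplitz sequence, as an exponent of `-1`; the binary digits of `s`
give the signs of the sequence and `f` is the number of levels. -/
def foldingBit : ℕ → ℕ → ℕ → ℕ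
  | 0, _, _ => 0
  | f + 1, s, t =>
    bif Nat.beq (t % 2) 0 then foldingBit f (s / 2) (t / 2) else (s + t / 2) % 2

/-- The effect of a step on the code of a point. -/
def codeStep (x : ℕ) : ℕ → ℕ
  | 0 => x + 1
  | 1 => x + 1000
  | 2 => x - 1
  | _ => x - 1000

/-- The codes of the points visited by a walk with seven levels, during `n` steps. -/
def foldingPath (s : ℕ) : ℕ → ℕ → ℕ → ℕ → List ℕ
  | 0, _, _, x => [x]
  | n + 1, t, d, x =>
    x :: foldingPath s n (t + 1) ((d + 1 + 2 * foldingBit 7 s (t + 1)) % 4) (codeStep x d)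

/-- Boolean membership test. -/
def memOnce (x : ℕ) : List ℕ → Bool
  | [] => false
  | y :: L => bif Nat.beq x y then true else memOnce x L

/-- Boolean test for double membership. -/
def memTwice (x : ℕ) : List ℕ → Bool
  | [] => false
  | y :: L => bif Nat.beq x y then memOnce x L else memTwice x L

/-- Test whether the point visited at the time `t` and its neighbours are visited twice. -/
def checkCross (L : List ℕ) (t : ℕ) : Bool :=
  match L[t]? with
  | none => false
  | some x => memTwice x L && memTwice (x + 1) L && memTwice (x - 1) L &&
      memTwice (x + 1000) L && memTwice (x - 1000) L

/-- The base case for large diamonds: each of the 128 choices of signs on seven levels is run for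
128 steps, and one of four candidate times is the centre of a cross of doubly visited points. The
start 200200 codes the origin as `200 + 1000 * 200`, so that no coordinate becomes negative. -/
theorem checkCross_foldingPath : ∀ s < 128,
    [40, 56, 20, 28].any (checkCross (foldingPath s 128 0 0 200200)) = true := by
  decide +kernel

theorem exists_getElem?_of_memOnce {x : ℕ} {L : List ℕ} (h : memOnce x L = true) :
    ∃ i : ℕ, L[i]? = some x := by
  induction L with
  | nil => simp [memOnce] at h
  | cons y L ih =>
    by_cases hxy : x = y
    · exact ⟨0, by simp [hxy]⟩
    · have : Nat.beq x y = false := by rw [← Bool.not_eq_true, Nat.beq_eq]; exact hxy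
      simp only [memOnce, this, cond_false] at h
      obtain ⟨i, hi⟩ := ih h
      exact ⟨i + 1, by simpa using hi⟩

theorem exists_getElem?_of_memTwice {x : ℕ} {L : List ℕ} (h : memTwice x L = true) :
    ∃ i j : ℕ, i < j ∧ L[i]? = some x ∧ L[j]? = some x := by
  induction L with
  | nil => simp [memTwice] at h
  | cons y L ih =>
    by_cases hxy : x = y
    · subst hxy
      have : Nat.beq x x = true := by simp
      simp only [memTwice, this, cond_true] at h
      obtain ⟨i, hi⟩ := exists_getElem?_of_memOnce h
      exact ⟨0, i + 1, by omega, by simp, by simpa using hi⟩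
    · have : Nat.beq x y = false := by rw [← Bool.not_eq_true, Nat.beq_eq]; exact hxy
      simp only [memTwice, this, cond_false] at h
      obtain ⟨i, j, hij, hi, hj⟩ := ih h
      exact ⟨i + 1, j + 1, by omega, by simpa using hi, by simpa using hj⟩

theorem exists_bitmask (K : ℕ) (σ : ℕ → ℤˣ) :
    ∃ s < 2 ^ K, ∀ j < K, σ j = (-1) ^ (s / 2 ^ j) := by
  induction K generalizing σ with
  | zero => exact ⟨0, by simp⟩
  | succ K ih =>
    obtain ⟨s, hs, h⟩ := ih fun j => σ (j + 1)
    obtain ⟨b, hb, hb'⟩ : ∃ b < 2, σ 0 = (-1) ^ b := by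
      rcases Int.units_eq_one_or (σ 0) with h | h
      · exact ⟨0, by simp [h]⟩
      · exact ⟨1, by simp [h]⟩
    refine ⟨b + 2 * s, by rw [pow_succ]; omega, ?_⟩
    intro j hj
    cases j with
    | zero => rw [hb']; simp [pow_add, pow_mul]
    | succ j =>
      rw [h j (by omega), pow_succ', ← Nat.div_div_eq_div_mul]
      congr 2
      omega

theorem IsToeplitz.eq_foldingBit {K : ℕ} {σ : ℕ → ℤˣ} {α : ℤ → ℤˣ} {s : ℕ}
    (h : IsToeplitz K σ α) (hs : ∀ j < K, σ j = (-1) ^ (s / 2 ^ j)) {t : ℕ} (ht : 0 < t)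
    (htK : t < 2 ^ K) : α t = (-1) ^ foldingBit K s t := by
  induction K generalizing σ α s t with
  | zero => omega
  | succ K ih =>
    rcases Nat.even_or_odd' t with ⟨m, rfl | rfl⟩
    · have h1 : IsToeplitz K (fun j => σ (j + 1)) (fun m => α (2 * m)) := by
        intro j hj q
        refine (congrArg α ?_).trans (h (j + 1) (by omega) q)
        ring
      have := ih (s := s / 2) (t := m) h1 ?_ (by omega) (by rw [pow_succ] at htK; omega)
      · simpa [foldingBit] using this
      · intro j hj
        rw [hs (j + 1) (by omega), pow_succ', Nat.div_div_eq_div_mul]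
    · have := h 0 (by omega) m
      simp only [pow_zero, one_mul] at this
      have hm : (2 * m + 1) / 2 = m := by omega
      have hm' : (2 * m + 1) % 2 = 1 := by omega
      have h2 : foldingBit (K + 1) s (2 * m + 1) = (s + m) % 2 := by
        rw [foldingBit, hm, hm']; rfl
      rw [h2, ← Int.units_pow_eq_pow_mod_two]
      push_cast
      rw [this, hs 0 (by omega), zpow_natCast, pow_add]
      simp

theorem iUnit_pow_four : (iUnit : GaussianIntˣ) ^ 4 = 1 := by decide

theorem iUnit_zpow_mul_pow (b d : ℕ) :
    iUnit ^ ((((-1) ^ b : ℤˣ) : ℤ)) * iUnit ^ d = iUnit ^ ((d + 1 + 2 * b) % 4) := by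
  rw [← pow_eq_pow_mod _ iUnit_pow_four]
  rcases Nat.even_or_odd' b with ⟨c, rfl | rfl⟩
  · rw [show d + 1 + 2 * (2 * c) = 1 + d + 4 * c by ring, pow_add, pow_add, pow_mul _ 4,
      iUnit_pow_four]
    simp [pow_mul]
  · rw [show d + 1 + 2 * (2 * c + 1) = 3 + d + 4 * c by ring, pow_add, pow_add, pow_mul _ 4,
      iUnit_pow_four, pow_add iUnit 3, show iUnit ^ 3 = iUnit⁻¹ by decide]
    simp [pow_mul]

/-- The code of a point. -/
def pointCode (v : GaussianInt) : ℕ := (200200 + v.re + 1000 * v.im).toNat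

theorem pointCode_inj {v w : GaussianInt} (hv : |v.re| ≤ 199 ∧ |v.im| ≤ 199)
    (hw : |w.re| ≤ 199 ∧ |w.im| ≤ 199) (h : pointCode v = pointCode w) : v = w := by
  simp only [abs_le] at hv hw
  unfold pointCode at h
  ext <;> omega

theorem pointCode_add_unit {v : GaussianInt} (hv : |v.re| ≤ 190 ∧ |v.im| ≤ 190) {d : ℕ}
    (hd : d < 4) : pointCode (v + (iUnit ^ d : GaussianIntˣ)) = codeStep (pointCode v) d := by
  simp only [abs_le] at hv
  have e0 : ((iUnit ^ 0 : GaussianIntˣ) : GaussianInt) = ⟨1, 0⟩ := rfl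
  have e1 : ((iUnit ^ 1 : GaussianIntˣ) : GaussianInt) = ⟨0, 1⟩ := rfl
  have e2 : ((iUnit ^ 2 : GaussianIntˣ) : GaussianInt) = ⟨-1, 0⟩ := rfl
  have e3 : ((iUnit ^ 3 : GaussianIntˣ) : GaussianInt) = ⟨0, -1⟩ := rfl
  have c0 : ∀ x, codeStep x 0 = x + 1 := fun _ => rfl
  have c1 : ∀ x, codeStep x 1 = x + 1000 := fun _ => rfl
  have c2 : ∀ x, codeStep x 2 = x - 1 := fun _ => rfl
  have c3 : ∀ x, codeStep x 3 = x - 1000 := fun _ => rfl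
  interval_cases d
  · rw [e0]; simp only [pointCode, c0, Zsqrtd.re_add, Zsqrtd.im_add]; omega
  · rw [e1]; simp only [pointCode, c1, Zsqrtd.re_add, Zsqrtd.im_add]; omega
  · rw [e2]; simp only [pointCode, c2, Zsqrtd.re_add, Zsqrtd.im_add]; omega
  · rw [e3]; simp only [pointCode, c3, Zsqrtd.re_add, Zsqrtd.im_add]; omega

theorem unit_eq_pow (ε : GaussianIntˣ) : ∃ d < 4, ε = iUnit ^ d := by
  rcases unit_eq ε with rfl | rfl | rfl | rfl
  · exact ⟨0, by decide⟩
  · exact ⟨2, by decide⟩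
  · exact ⟨1, by decide⟩
  · exact ⟨3, by decide⟩

theorem IsWalk.abs_le {y D α} (h : IsWalk y D α) (h0 : y 0 = 0) (t : ℕ) :
    |(y t).re| ≤ t ∧ |(y t).im| ≤ t := by
  induction t with
  | zero => simp [h0]
  | succ t ih =>
    have := h.step t
    push_cast
    rw [this]
    simp only [_root_.abs_le] at *
    rcases unit_eq (D t) with hd | hd | hd | hd <;> rw [hd] <;> simp <;> omega

/-- Seven levels determine the turns at the times 1 to 127. The direction stored for time 128 is
never used, whence the restriction `t < 128` on `hD`. -/
theorem IsWalk.foldingPath_eq {y D α} (h : IsWalk y D α) (h0 : y 0 = 0) {s : ℕ}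
    (hα : ∀ t : ℕ, 0 < t → t < 2 ^ 7 → α t = (-1) ^ foldingBit 7 s t) {n t d : ℕ}
    (hn : t + n ≤ 128) (hd : d < 4) (hD : t < 128 → D t = iUnit ^ d) :
    foldingPath s n t d (pointCode (y t)) =
      (List.range (n + 1)).map fun i : ℕ => pointCode (y ((t + i : ℕ) : ℤ)) := by
  induction n generalizing t d with
  | zero => simp [foldingPath]
  | succ n ih =>
    rw [foldingPath, List.range_succ_eq_map, List.map_cons, List.map_map]
    have hD := hD (by omega)
    have hstep := h.step t
    have hb := h.abs_le h0 t
    simp only [_root_.abs_le] at hb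
    have hcode : codeStep (pointCode (y t)) d = pointCode (y ((t + 1 : ℕ) : ℤ)) := by
      push_cast
      rw [hstep, hD, pointCode_add_unit (by simp only [_root_.abs_le]; omega) hd]
    rw [hcode, ih (by omega) (Nat.mod_lt _ (by norm_num))]
    · simp only [add_zero, List.cons.injEq, true_and]
      refine List.map_congr_left fun i _ => ?_
      simp only [Function.comp]
      congr 2
      push_cast; ring
    · intro ht
      push_cast
      have ha := hα (t + 1) (by omega) (by omega)
      push_cast at ha
      rw [h.turn, hD, ha, iUnit_zpow_mul_pow]

theorem IsWalk.exists_cross_of_normalized {y D α} (h : IsWalk y D α) (h0 : y 0 = 0)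
    (hD : D 0 = 1) {σ : ℕ → ℤˣ} (hα : IsToeplitz 7 σ α) :
    ∃ t, y t ∈ doublePoints y ∧ ∀ ε : GaussianIntˣ, y t + ε ∈ doublePoints y := by
  obtain ⟨s, hs, hσ⟩ := exists_bitmask 7 σ
  have hpath := h.foldingPath_eq h0 (fun t => hα.eq_foldingBit hσ) (n := 128) (t := 0) (d := 0)
    (by omega) (by omega) (by simpa using hD)
  have hcheck := checkCross_foldingPath s (by simpa using hs)
  have hc0 : pointCode (y ((0 : ℕ) : ℤ)) = 200200 := by simp [h0, pointCode]
  rw [hc0] at hpath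
  rw [hpath, List.any_eq_true] at hcheck
  obtain ⟨t, ht, hcheck⟩ := hcheck
  have htlt : t < 57 := by simp at ht; omega
  have hget : ∀ i x : ℕ, ((List.range (128 + 1)).map
      fun i : ℕ => pointCode (y ((0 + i : ℕ) : ℤ)))[i]? = some x →
        i ≤ 128 ∧ x = pointCode (y i) := by
    intro i x hx
    rw [List.getElem?_map, Option.map_eq_some_iff] at hx
    obtain ⟨k, hk, rfl⟩ := hx
    rw [List.getElem?_eq_some_iff] at hk
    obtain ⟨hi, hk⟩ := hk
    rw [List.getElem_range] at hk
    subst hk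
    simp at hi ⊢
    omega
  have hb := h.abs_le h0 t
  simp only [_root_.abs_le] at hb
  have hdouble : ∀ v : GaussianInt, |v.re| ≤ 199 ∧ |v.im| ≤ 199 →
      memTwice (pointCode v) ((List.range (128 + 1)).map
        fun i : ℕ => pointCode (y ((0 + i : ℕ) : ℤ))) = true → v ∈ doublePoints y := by
    intro v hv hm
    obtain ⟨i, j, hij, hi, hj⟩ := exists_getElem?_of_memTwice hm
    obtain ⟨hi, hi'⟩ := hget _ _ hi
    obtain ⟨hj, hj'⟩ := hget _ _ hj
    have bi := h.abs_le h0 i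
    have bj := h.abs_le h0 j
    exact ⟨i, j, by omega, (pointCode_inj hv (by omega) hi').symm,
      (pointCode_inj hv (by omega) hj').symm⟩
  unfold checkCross at hcheck
  rw [show ((List.range (128 + 1)).map
      fun i : ℕ => pointCode (y ((0 + i : ℕ) : ℤ)))[t]? = some (pointCode (y t)) by
    rw [List.getElem?_map, List.getElem?_range (by omega)]; simp] at hcheck
  simp only [Bool.and_eq_true] at hcheck
  obtain ⟨⟨⟨⟨c0, c1⟩, c2⟩, c3⟩, c4⟩ := hcheck
  refine ⟨t, hdouble _ (by simp only [_root_.abs_le]; omega) c0, ?_⟩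
  intro ε
  obtain ⟨d, hd, rfl⟩ := unit_eq_pow ε
  have hstep : |(y t + (iUnit ^ d : GaussianIntˣ)).re| ≤ 199 ∧
      |(y t + (iUnit ^ d : GaussianIntˣ)).im| ≤ 199 := by
    rcases unit_eq (iUnit ^ d) with h | h | h | h <;> rw [h] <;>
      simp [_root_.abs_le] <;> omega
  refine hdouble _ hstep ?_
  rw [pointCode_add_unit (by simp only [_root_.abs_le]; omega) hd]
  interval_cases d
  · exact c1
  · exact c3
  · exact c2
  · exact c4

theorem IsWalk.exists_cross {y D α} (h : IsWalk y D α) {σ : ℕ → ℤˣ} (hα : IsToeplitz 7 σ α) :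
    ∃ t, y t ∈ doublePoints y ∧ ∀ ε : GaussianIntˣ, y t + ε ∈ doublePoints y := by
  -- A translation and a rotation reduce to a walk starting at 0 in the direction 1, without
  -- changing the turns.
  have hn : IsWalk (fun t => ((D 0)⁻¹ : GaussianIntˣ) * (y t - y 0)) (fun t => (D 0)⁻¹ * D t) α :=
    ⟨fun t => by rw [h.step]; push_cast; ring, fun t => by rw [h.turn, mul_left_comm]⟩
  obtain ⟨t, h1, h2⟩ := hn.exists_cross_of_normalized (by simp) (by simp) hα
  have hmul : ∀ v w : GaussianInt, ((D 0)⁻¹ : GaussianIntˣ) * v = w ↔ v = D 0 * w :=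
    fun v w => by rw [Units.inv_mul_eq_iff_eq_mul]
  refine ⟨t, ?_, fun ε => ?_⟩
  · obtain ⟨t1, t2, hne, e1, e2⟩ := h1
    simp only [hmul, Units.mul_inv_cancel_left, sub_left_inj] at e1 e2
    exact ⟨t1, t2, hne, e1, e2⟩
  · obtain ⟨t1, t2, hne, e1, e2⟩ := h2 ((D 0)⁻¹ * ε)
    simp only [hmul, Units.mul_inv_cancel_left, mul_add, Units.val_mul] at e1 e2
    exact ⟨t1, t2, hne, by linear_combination e1, by linear_combination e2⟩

/-! ### Large diamonds of doubly visited points -/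

section Walk

variable {y : ℤ → GaussianInt} {D : ℤ → GaussianIntˣ} {α : ℤ → ℤˣ}

/-- A walk which does not use twice the same oriented segment passes through all the edges at a
point which it visits twice. -/
theorem IsWalk.exists_edge_of_double (h : IsWalk y D α)
    (hinj : ∀ t t', y t = y t' → D t = D t' → t = t') {v : GaussianInt}
    (hv : v ∈ doublePoints y) (ε : GaussianIntˣ) :
    ∃ t, y t = v ∧ (D t = ε ∨ D (t - 1) = -ε) := by
  obtain ⟨t, t', hne, ht, ht'⟩ := hv
  have hpar : Even t ↔ Even t' := by
    rw [← h.even_iff t, ← h.even_iff t', ht, ht']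
  have hs : y t = y (t - 1) + D (t - 1) := by simpa using h.step (t - 1)
  have hs' : y t' = y (t' - 1) + D (t' - 1) := by simpa using h.step (t' - 1)
  -- Both visits occur at times of the same parity, hence leave along the same axis; they leave, and
  -- likewise arrive, in opposite directions since no oriented segment is repeated. Together they
  -- use all four edges.
  have h1 : D t = -D t' := by
    refine (eq_or_eq_neg_of_isHor_iff ?_).resolve_left fun h1 => hne (hinj _ _ (by rw [ht, ht']) h1)
    rw [h.isHor_iff t, h.isHor_iff t', hpar]
  have h2 : D (t - 1) = -D (t' - 1) := by
    refine (eq_or_eq_neg_of_isHor_iff ?_).resolve_left fun h1 => hne ?_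
    · rw [h.isHor_iff (t - 1), h.isHor_iff (t' - 1), Int.even_sub, Int.even_sub, hpar]
    · have : t - 1 = t' - 1 := hinj _ _ (by
        rw [h1, ht] at hs
        rw [ht'] at hs'
        exact add_right_cancel (hs.symm.trans hs')) h1
      omega
  have hturn : IsHor (D t) ↔ ¬ IsHor (D (t - 1)) := by
    rw [h.isHor_iff t, h.isHor_iff (t - 1), Int.even_sub]
    by_cases hh : IsHor (D 0) <;> simp [hh]
  by_cases hε : IsHor (D t) ↔ IsHor ε
  · rcases eq_or_eq_neg_of_isHor_iff hε with h3 | h3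
    · exact ⟨t, ht, Or.inl h3⟩
    · exact ⟨t', ht', Or.inl (by rw [← neg_eq_iff_eq_neg.mpr h1, h3, neg_neg])⟩
  · have hε' : IsHor (D (t - 1)) ↔ IsHor ε := by
      by_cases c1 : IsHor (D t) <;> by_cases c2 : IsHor (D (t - 1)) <;>
        by_cases c3 : IsHor ε <;> simp_all
    rcases eq_or_eq_neg_of_isHor_iff hε' with h3 | h3
    · exact ⟨t', ht', Or.inr (by rw [← neg_eq_iff_eq_neg.mpr h2, h3])⟩
    · exact ⟨t, ht, Or.inr h3⟩

/-- A doubly visited neighbour forces the edge from it to `w` to be used, and a single visit to `w`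
uses only two edges. -/
theorem IsWalk.double_of_three_neighbors (h : IsWalk y D α)
    (hinj : ∀ t t', y t = y t' → D t = D t' → t = t') {w : GaussianInt} {ε₁ ε₂ ε₃ : GaussianIntˣ}
    (h12 : ε₁ ≠ ε₂) (h13 : ε₁ ≠ ε₃) (h23 : ε₂ ≠ ε₃) (h1 : w + ε₁ ∈ doublePoints y)
    (h2 : w + ε₂ ∈ doublePoints y) (h3 : w + ε₃ ∈ doublePoints y) : w ∈ doublePoints y := by
  have key : ∀ ε : GaussianIntˣ, w + ε ∈ doublePoints y →
      ∃ t, y t = w ∧ (D t = ε ∨ D (t - 1) = -ε) := by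
    intro ε hε
    obtain ⟨t, ht, hD | hD⟩ := h.exists_edge_of_double hinj hε (-ε)
    · refine ⟨t + 1, ?_, Or.inr (by simpa using hD)⟩
      rw [h.step, ht, hD]; simp
    · refine ⟨t - 1, ?_, Or.inl (by simpa using hD)⟩
      have hs : y t = y (t - 1) + D (t - 1) := by simpa using h.step (t - 1)
      rw [hD, ht] at hs
      simpa using hs.symm
  obtain ⟨t1, ht1, hD1⟩ := key _ h1
  obtain ⟨t2, ht2, hD2⟩ := key _ h2
  obtain ⟨t3, ht3, hD3⟩ := key _ h3
  by_cases e12 : t1 = t2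
  · by_cases e13 : t1 = t3
    · exfalso
      subst e12 e13
      rcases hD1 with hD1 | hD1 <;> rcases hD2 with hD2 | hD2 <;> rcases hD3 with hD3 | hD3 <;>
        simp_all
    · exact ⟨t1, t3, e13, ht1, ht3⟩
  · exact ⟨t1, t2, e12, ht1, ht2⟩

/-- Directions on the same axis differ by a sign, while two derived factors never differ by a sign.
This carries over to the derived walk the property of not repeating an oriented segment. -/
theorem derivedFactor_cancel {a a' : ℤˣ} {ε ε' : GaussianIntˣ} (hε : IsHor ε ↔ IsHor ε')
    (h : ε * derivedFactor a = ε' * derivedFactor a') : ε = ε' := by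
  rcases eq_or_eq_neg_of_isHor_iff hε with h1 | rfl
  · exact h1
  · exfalso
    rw [neg_mul, ← mul_neg, mul_right_inj] at h
    revert h a a'
    decide

theorem exists_three_neighbors {P : GaussianInt → Prop} {w : GaussianInt}
    (h : (P (w + 1) ∧ P (w - 1) ∧ (P (w + ⟨0, 1⟩) ∨ P (w - ⟨0, 1⟩))) ∨
      (P (w + ⟨0, 1⟩) ∧ P (w - ⟨0, 1⟩) ∧ (P (w + 1) ∨ P (w - 1)))) :
    ∃ ε₁ ε₂ ε₃ : GaussianIntˣ, ε₁ ≠ ε₂ ∧ ε₁ ≠ ε₃ ∧ ε₂ ≠ ε₃ ∧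
      P (w + ε₁) ∧ P (w + ε₂) ∧ P (w + ε₃) := by
  have e1 : w + ((-1 : GaussianIntˣ) : GaussianInt) = w - 1 := by simp; ring
  have e2 : w + ((-iUnit : GaussianIntˣ) : GaussianInt) = w - ⟨0, 1⟩ := by
    rw [Units.val_neg, iUnit_val]; ring
  have e3 : w + ((1 : GaussianIntˣ) : GaussianInt) = w + 1 := by simp
  have e4 : w + ((iUnit : GaussianIntˣ) : GaussianInt) = w + ⟨0, 1⟩ := rfl
  rcases h with ⟨h1, h2, h3 | h3⟩ | ⟨h1, h2, h3 | h3⟩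
  · exact ⟨1, -1, iUnit, by decide, by decide, by decide, e3 ▸ h1, e1 ▸ h2, e4 ▸ h3⟩
  · exact ⟨1, -1, -iUnit, by decide, by decide, by decide, e3 ▸ h1, e1 ▸ h2, e2 ▸ h3⟩
  · exact ⟨iUnit, -iUnit, 1, by decide, by decide, by decide, e4 ▸ h1, e2 ▸ h2, e3 ▸ h3⟩
  · exact ⟨iUnit, -iUnit, -1, by decide, by decide, by decide, e4 ▸ h1, e2 ▸ h2, e1 ▸ h3⟩

theorem IsWalk.double_of_neighbors (h : IsWalk y D α)
    (hinj : ∀ t t', y t = y t' → D t = D t' → t = t') {w : GaussianInt}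
    (hw : (w + 1 ∈ doublePoints y ∧ w - 1 ∈ doublePoints y ∧
        (w + ⟨0, 1⟩ ∈ doublePoints y ∨ w - ⟨0, 1⟩ ∈ doublePoints y)) ∨
      (w + ⟨0, 1⟩ ∈ doublePoints y ∧ w - ⟨0, 1⟩ ∈ doublePoints y ∧
        (w + 1 ∈ doublePoints y ∨ w - 1 ∈ doublePoints y))) : w ∈ doublePoints y := by
  obtain ⟨ε₁, ε₂, ε₃, n1, n2, n3, p1, p2, p3⟩ :=
    exists_three_neighbors (P := fun v => v ∈ doublePoints y) hw
  exact h.double_of_three_neighbors hinj n1 n2 n3 p1 p2 p3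

/-- A set of even points which are visited twice, together with the odd points with sufficiently
many neighbours in it. -/
theorem IsWalk.double_of_even_double (h : IsWalk y D α)
    (hinj : ∀ t t', y t = y t' → D t = D t' → t = t') {u : GaussianInt} (R : ℤ → ℤ → Prop)
    (hR : ∀ a b : ℤ, Even (a + b) → R a b → u + ⟨a, b⟩ ∈ doublePoints y)
    (hodd : ∀ a b : ℤ, Odd (a + b) → R a b →
      (R (a + 1) b ∧ R (a - 1) b ∧ (R a (b + 1) ∨ R a (b - 1))) ∨
      (R a (b + 1) ∧ R a (b - 1) ∧ (R (a + 1) b ∨ R (a - 1) b)))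
    {a b : ℤ} (hab : R a b) : u + ⟨a, b⟩ ∈ doublePoints y := by
  by_cases he : Even (a + b)
  · exact hR a b he hab
  · rw [Int.not_even_iff_odd] at he
    have e1 : u + ⟨a, b⟩ + 1 = u + ⟨a + 1, b⟩ := by ext <;> simp; ring
    have e2 : u + ⟨a, b⟩ - 1 = u + ⟨a - 1, b⟩ := by ext <;> simp; ring
    have e3 : u + ⟨a, b⟩ + ⟨0, 1⟩ = u + ⟨a, b + 1⟩ := by ext <;> simp; ring
    have e4 : u + ⟨a, b⟩ - ⟨0, 1⟩ = u + ⟨a, b - 1⟩ := by ext <;> simp; ring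
    have p1 : Even (a + 1 + b) := by have := he.add_one; rwa [add_right_comm] at this
    have p2 : Even (a - 1 + b) := by have := he.sub_odd odd_one; rwa [sub_add_eq_add_sub]
    have p3 : Even (a + (b + 1)) := by have := he.add_one; rwa [add_assoc] at this
    have p4 : Even (a + (b - 1)) := by have := he.sub_odd odd_one; rwa [add_sub_assoc] at this
    apply h.double_of_neighbors hinj
    rw [e1, e2, e3, e4]
    have := hodd a b he hab
    have g1 := hR _ _ p1
    have g2 := hR _ _ p2
    have g3 := hR _ _ p3
    have g4 := hR _ _ p4
    tauto

/-- Multiplication by `1 + i` sends `a + b i` to `(a - b) + (a + b) i`: it maps a diamond of radius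
`ρ` onto the even points of a square of half-side `ρ`, and such a square onto the even points of a
diamond of radius `2 * ρ`. -/
theorem even_double_of_derived {y' : ℤ → GaussianInt}
    (hy : ∀ m, y (2 * m) = y 0 + oneAddI * y' m) {u' : GaussianInt} {R R' : ℤ → ℤ → Prop}
    (hu : ∀ a b, R' a b → u' + ⟨a, b⟩ ∈ doublePoints y')
    (hRR' : ∀ a b, R (a - b) (a + b) → R' a b) (a b : ℤ) (hab : Even (a + b)) (h : R a b) :
    y 0 + oneAddI * u' + ⟨a, b⟩ ∈ doublePoints y := by
  obtain ⟨r, hr⟩ := hab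
  obtain ⟨m, m', hm, e1, e2⟩ := hu r (r - a) (hRR' _ _ (by
    convert h using 1 <;> omega))
  have : y 0 + oneAddI * u' + ⟨a, b⟩ = y 0 + oneAddI * (u' + ⟨r, r - a⟩) := by
    ext <;> simp <;> omega
  rw [this]
  exact ⟨2 * m, 2 * m', by omega, by rw [hy, e1], by rw [hy, e2]⟩

/-- If the derived walk visits twice all the points of a diamond, then the walk visits twice all
the points of a square. -/
theorem IsWalk.square_double_of_diamond (h : IsWalk y D α)
    (hinj : ∀ t t', y t = y t' → D t = D t' → t = t') {y' : ℤ → GaussianInt}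
    (hy : ∀ m, y (2 * m) = y 0 + oneAddI * y' m) {ρ : ℤ} (hρ : 1 ≤ ρ) {u' : GaussianInt}
    (hu : ∀ a b : ℤ, |a| + |b| ≤ ρ → u' + ⟨a, b⟩ ∈ doublePoints y') :
    ∃ u : GaussianInt, ∀ a b : ℤ, |a| ≤ ρ ∧ |b| ≤ ρ → u + ⟨a, b⟩ ∈ doublePoints y := by
  refine ⟨y 0 + oneAddI * u', fun a b hab => h.double_of_even_double hinj
    (fun a b : ℤ => |a| ≤ ρ ∧ |b| ≤ ρ) (even_double_of_derived hy hu ?_) ?_ hab⟩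
  · intro a b hab
    simp only [_root_.abs_le] at hab
    rcases abs_cases a with ⟨c1, _⟩ | ⟨c1, _⟩ <;>
      rcases abs_cases b with ⟨c2, _⟩ | ⟨c2, _⟩ <;> omega
  -- The corners of the square are even, so an odd point has at least three neighbours in it.
  · rintro a b ⟨r, hr⟩ hab
    simp only [_root_.abs_le] at hab ⊢
    omega

/-- If the derived walk visits twice all the points of a square, then the walk visits twice all
the points of a diamond. -/
theorem IsWalk.diamond_double_of_square (h : IsWalk y D α)
    (hinj : ∀ t t', y t = y t' → D t = D t' → t = t') {y' : ℤ → GaussianInt}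
    (hy : ∀ m, y (2 * m) = y 0 + oneAddI * y' m) {ρ : ℤ} {u' : GaussianInt}
    (hu : ∀ a b : ℤ, |a| ≤ ρ ∧ |b| ≤ ρ → u' + ⟨a, b⟩ ∈ doublePoints y') :
    ∃ u : GaussianInt, ∀ a b : ℤ, |a| + |b| ≤ 2 * ρ → u + ⟨a, b⟩ ∈ doublePoints y := by
  have key : ∀ a b : ℤ, |a| + |b| ≤ 2 * ρ ↔
      a + b ≤ 2 * ρ ∧ a - b ≤ 2 * ρ ∧ -a + b ≤ 2 * ρ ∧ -a - b ≤ 2 * ρ := by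
    intro a b
    rcases abs_cases a with ⟨c1, _⟩ | ⟨c1, _⟩ <;>
      rcases abs_cases b with ⟨c2, _⟩ | ⟨c2, _⟩ <;> omega
  refine ⟨y 0 + oneAddI * u', fun a b hab => h.double_of_even_double hinj
    (fun a b : ℤ => |a| + |b| ≤ 2 * ρ) (even_double_of_derived hy hu ?_) ?_ hab⟩
  · intro a b hab
    rw [key] at hab
    simp only [_root_.abs_le]
    omega
  -- The boundary of the diamond consists of even points, since `2 * ρ` is even, so all the
  -- neighbours of an odd point belong to it.
  · rintro a b ⟨r, hr⟩ hab
    simp only [key] at hab ⊢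
    omega

theorem IsWalk.derived_injective (h : IsWalk y D α)
    (hinj : ∀ t t', y t = y t' → D t = D t' → t = t') {y' : ℤ → GaussianInt}
    (hy : ∀ m, y (2 * m) = y 0 + oneAddI * y' m) (m m' : ℤ) (hm : y' m = y' m')
    (hD : D (2 * m) * derivedFactor (α (2 * m + 1)) =
      D (2 * m') * derivedFactor (α (2 * m' + 1))) : m = m' := by
  have := hinj (2 * m) (2 * m') (by rw [hy, hy, hm]) (derivedFactor_cancel (by
    rw [h.isHor_iff (2 * m), h.isHor_iff (2 * m')]; simp) hD)
  omega

end Walk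

/-- A folding walk which does not use twice the same oriented segment visits twice all the points
of arbitrarily large diamonds. -/
theorem IsWalk.exists_diamond_double (n : ℕ) {y : ℤ → GaussianInt} {D : ℤ → GaussianIntˣ}
    {α : ℤ → ℤˣ} (h : IsWalk y D α) (hinj : ∀ t t', y t = y t' → D t = D t' → t = t')
    {σ : ℕ → ℤˣ} (hα : IsToeplitz (2 * n + 7) σ α) :
    ∃ u : GaussianInt, ∀ a b : ℤ, |a| + |b| ≤ 2 ^ n → u + ⟨a, b⟩ ∈ doublePoints y := by
  induction n generalizing y D α σ with
  | zero =>
    obtain ⟨t, h0, h1⟩ := h.exists_cross hα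
    refine ⟨y t, fun a b hab => ?_⟩
    have : (a = 0 ∧ b = 0) ∨ (a = 1 ∧ b = 0) ∨ (a = -1 ∧ b = 0) ∨ (a = 0 ∧ b = 1) ∨
        (a = 0 ∧ b = -1) := by
      rcases abs_cases a with ⟨c1, _⟩ | ⟨c1, _⟩ <;>
        rcases abs_cases b with ⟨c2, _⟩ | ⟨c2, _⟩ <;> omega
    rcases this with ⟨rfl, rfl⟩ | ⟨rfl, rfl⟩ | ⟨rfl, rfl⟩ | ⟨rfl, rfl⟩ | ⟨rfl, rfl⟩
    · convert h0; ext <;> simp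
    · exact h1 1
    · exact h1 (-1)
    · exact h1 iUnit
    · exact h1 (-iUnit)
  | succ n ih =>
    -- Two derivations cost two levels and turn a diamond into a square and back into a diamond of
    -- twice the radius.
    obtain ⟨y₁, h₁, hα₁, hy₁, -⟩ := h.exists_derived (N := 2 * n + 8) hα
    have hinj₁ := h.derived_injective hinj hy₁
    obtain ⟨y₂, h₂, hα₂, hy₂, -⟩ := h₁.exists_derived (N := 2 * n + 7) hα₁
    obtain ⟨u₂, hu₂⟩ := ih h₂ (h₁.derived_injective hinj₁ hy₂) hα₂
    obtain ⟨u₁, hu₁⟩ := h₁.square_double_of_diamond hinj₁ hy₂ (one_le_pow₀ (by norm_num)) hu₂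
    rw [pow_succ']
    exact h.diamond_double_of_square hinj hy₁ hu₁

/-! ### Segments, complete curves and their hierarchies -/

theorem Seg.translate_translate (u v : GaussianInt) (A : Seg) :
    (A.translate v).translate u = A.translate (u + v) := by
  ext : 1
  · exact (add_assoc _ _ _).symm
  · rfl

theorem Seg.term_translate (u : GaussianInt) (A : Seg) : (A.translate u).term = u + A.term :=
  add_assoc _ _ _

theorem Seg.translate_zero (A : Seg) : A.translate 0 = A := by
  ext : 1
  · exact zero_add _
  · rfl

theorem Seg.edge_eq_iff (A B : Seg) :
    A.edge = B.edge ↔ A = B ∨ (A.init = B.term ∧ A.dir = -B.dir) := by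
  unfold Seg.edge
  rw [Sym2.eq_iff]
  constructor
  · rintro (⟨h1, h2⟩ | ⟨h1, h2⟩)
    · left
      ext : 1
      · exact h1
      · unfold Seg.term at h2
        rw [h1, add_right_inj] at h2
        exact Units.ext h2
    · right
      refine ⟨h1, ?_⟩
      unfold Seg.term at h1 h2
      ext1
      rw [h1] at h2
      push_cast
      linear_combination h2
  · rintro (rfl | ⟨h1, h2⟩)
    · simp
    · right
      refine ⟨h1, ?_⟩
      unfold Seg.term at *
      rw [h1, h2]
      push_cast
      ring

/-- The segment of index `k` of a curve, with a junk value if there is no such segment. -/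
noncomputable def Curve.segAt (c : Curve) (k : ℤ) : Seg :=
  open Classical in if h : k ∈ c.idx then c.seg ⟨k, h⟩ else ⟨0, 1⟩

theorem Curve.segAt_eq (c : Curve) {k : ℤ} (h : k ∈ c.idx) : c.segAt k = c.seg ⟨k, h⟩ :=
  dif_pos h

theorem Curve.segAt_coe (c : Curve) (k : c.idx) : c.segAt k = c.seg k := c.segAt_eq k.2

theorem Curve.segAt_mem (c : Curve) {k : ℤ} (h : k ∈ c.idx) : c.segAt k ∈ c.segs :=
  ⟨⟨k, h⟩, (c.segAt_eq h).symm⟩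

theorem Curve.IsComplete.mem {c : Curve} (hc : c.IsComplete) (k : ℤ) : k ∈ c.idx := by
  rw [hc]; trivial

theorem Curve.IsComplete.term_eq {c : Curve} (hc : c.IsComplete) (k : ℤ) :
    (c.segAt k).term = (c.segAt (k + 1)).init := by
  rw [c.segAt_eq (hc.mem k), c.segAt_eq (hc.mem (k + 1))]
  exact c.term_eq_init _ _ rfl

theorem Curve.IsComplete.dir_eq {c : Curve} (hc : c.IsComplete) {a : ℤ → ℤˣ}
    (ha : c.IsAssociatedTo a) (k : ℤ) :
    (c.segAt (k + 1)).dir = iUnit ^ (a k : ℤ) * (c.segAt k).dir := by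
  rw [c.segAt_eq (hc.mem k), c.segAt_eq (hc.mem (k + 1))]
  exact ha ⟨k, hc.mem k⟩ ⟨k + 1, hc.mem _⟩ rfl

theorem iUnit_zpow_injective {a b : ℤˣ} (h : iUnit ^ (a : ℤ) = iUnit ^ (b : ℤ)) : a = b := by
  revert a b
  decide

theorem Curve.IsComplete.associated_unique {c : Curve} (hc : c.IsComplete) {a b : ℤ → ℤˣ}
    (ha : c.IsAssociatedTo a) (hb : c.IsAssociatedTo b) : a = b := by
  funext k
  have h1 := hc.dir_eq ha k
  rw [hc.dir_eq hb k, mul_left_inj] at h1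
  exact (iUnit_zpow_injective h1).symm

/-- The turn `a k` takes place where segment `k + 1` begins, whence the `+ 1`; the shift by `τ` puts
the Toeplitz origin at time 0. -/
theorem Curve.IsComplete.isWalk {c : Curve} (hc : c.IsComplete) {a : ℤ → ℤˣ}
    (ha : c.IsAssociatedTo a) (τ : ℤ) :
    IsWalk (fun t => (c.segAt (t - τ + 1)).init) (fun t => (c.segAt (t - τ + 1)).dir)
      (fun t => a (t - τ)) := by
  constructor
  · intro t
    rw [show t + 1 - τ + 1 = t - τ + 1 + 1 by ring, ← hc.term_eq]
    rfl
  · intro t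
    rw [show t + 1 - τ = t - τ + 1 by ring, hc.dir_eq ha]

/-- At all levels less than `N`, the vertices of the curve which disappear are the points
`z + (1 + i) ^ n * w` with `w` odd, and the turns at these points are given by the sign `s n`
of the level and by `w`. -/
structure Curve.IsHierarchical (c : Curve) (a : ℤ → ℤˣ) (N : ℕ) (z : GaussianInt)
    (s : ℕ → ℤˣ) : Prop where
  mem_seqE_iff : ∀ n ≤ N, ∀ k, k ∈ seqE a n ↔ oneAddI ^ n ∣ (c.segAt k).term - z
  turn_eq : ∀ n < N, ∀ k w, Odd (w.re + w.im) → (c.segAt k).term = z + oneAddI ^ n * w →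
    a k = s n * altSign w

theorem Curve.IsComplete.exists_isHierarchical {c : Curve} (hc : c.IsComplete) {a : ℤ → ℤˣ}
    (ha : c.IsAssociatedTo a) {N : ℕ} {σ : ℕ → ℤˣ} {τ : ℤ}
    (h : IsToeplitz (N + 1) σ fun t => a (t - τ)) : ∃ z s, c.IsHierarchical a N z s := by
  have hw := hc.isWalk ha τ
  obtain ⟨s, hs⟩ := hw.exists_sign h
  have hterm : ∀ k, (c.segAt k).term = (c.segAt (k + τ - τ + 1)).init := fun k => by
    rw [hc.term_eq]; congr 2; ring
  refine ⟨(c.segAt (0 - τ + 1)).init, s, ?_, ?_⟩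
  · intro n hn k
    rw [h.mem_seqE_iff (by omega), hterm]
    exact (hw.pow_dvd_iff h (by omega) (k + τ)).symm
  · intro n hn k w hw' hk
    rw [hterm] at hk
    have := hs n (by omega) (k + τ) w hw' hk
    simpa using this

theorem odd_of_not_dvd {n : ℕ} {w : GaussianInt} (h : ¬ oneAddI ^ (n + 1) ∣ oneAddI ^ n * w) :
    Odd (w.re + w.im) := by
  rw [← Int.not_even_iff_odd, ← oneAddI_dvd_iff]
  intro hd
  exact h (by rw [pow_succ]; exact mul_dvd_mul_left _ hd)

theorem odd_of_sub_dvd {w w' : GaussianInt} (h : oneAddI ∣ w - w') (hw : Odd (w.re + w.im)) :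
    Odd (w'.re + w'.im) := by
  rw [← Int.not_even_iff_odd, ← oneAddI_dvd_iff] at *
  intro hd
  exact hw (by simpa using dvd_add h hd)

/-- Moving the base point of a hierarchy. -/
theorem exists_add_pow_mul {n N : ℕ} (hn : n < N) {z z' : GaussianInt}
    (h : oneAddI ^ (N + 1) ∣ z - z') (w : GaussianInt) :
    ∃ w', z + oneAddI ^ n * w = z' + oneAddI ^ n * w' ∧ oneAddI ^ 2 ∣ w - w' := by
  obtain ⟨g, hg⟩ := h
  obtain ⟨d, rfl⟩ := Nat.exists_eq_add_of_lt hn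
  refine ⟨w + oneAddI ^ (d + 2) * g, ?_, ⟨-(oneAddI ^ d * g), by ring⟩⟩
  linear_combination hg

/-- If a long part of a hierarchical curve is a translate of a part of another one, then the
hierarchies correspond. -/
theorem Curve.IsHierarchical.compare {c e : Curve} (hc : c.IsComplete) (he : e.IsComplete)
    {a b : ℤ → ℤˣ} (ha : c.IsAssociatedTo a) (hb : e.IsAssociatedTo b) {N : ℕ}
    {σ σ' : ℕ → ℤˣ} {τ τ' : ℤ} (hσ : IsToeplitz (N + 2) σ fun t => a (t - τ))
    (hσ' : IsToeplitz (N + 2) σ' fun t => b (t - τ')) {z z' : GaussianInt} {s s' : ℕ → ℤˣ}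
    (h : c.IsHierarchical a (N + 1) z s) (h' : e.IsHierarchical b (N + 1) z' s')
    {u : GaussianInt} {m : ℤ}
    (hu : ∀ k : ℤ, 0 ≤ k → k ≤ 2 ^ (N + 4) + 1 → e.segAt (k + m) = (c.segAt k).translate u) :
    oneAddI ^ (N + 1) ∣ z + u - z' ∧ ∀ n < N, s n = s' n := by
  have hab : ∀ k : ℤ, 0 ≤ k → k ≤ 2 ^ (N + 4) → a k = b (k + m) := by
    intro k h0 h1
    have e1 := hc.dir_eq ha k
    have e2 := he.dir_eq hb (k + m)
    rw [show k + m + 1 = k + 1 + m by ring, hu k h0 (by omega),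
      hu (k + 1) (by omega) (by omega)] at e2
    change (c.segAt (k + 1)).dir = _ * (c.segAt k).dir at e2
    rw [e1, mul_left_inj] at e2
    exact iUnit_zpow_injective e2
  have hdvd : (2 : ℤ) ^ (N + 1) ∣ m + τ' - τ := by
    refine hσ.dvd_sub_of_eqOn hσ' (k₀ := τ) ?_
    intro k h0 h1
    rw [hab (k - τ) (by omega) (by rw [show N + 4 = N + 1 + 3 by ring]; omega)]
    congr 1; ring
  have hterm : ∀ k : ℤ, 0 ≤ k → k ≤ 2 ^ (N + 4) → (e.segAt (k + m)).term = u + (c.segAt k).term :=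
    fun k h0 h1 => by rw [hu k h0 (by omega), Seg.term_translate]
  have hpos : (0 : ℤ) < 2 ^ (N + 1) := by positivity
  have hpow : (2 : ℤ) ^ (N + 4) = 8 * 2 ^ (N + 1) := by ring
  have hz : oneAddI ^ (N + 1) ∣ z + u - z' := by
    have h1 : (-τ) % 2 ^ (N + 1) < 2 ^ (N + 1) := Int.emod_lt_of_pos _ hpos
    have h0 : 0 ≤ (-τ) % 2 ^ (N + 1) := Int.emod_nonneg _ hpos.ne'
    -- The first position `k ≥ 0` of level at least `N + 1` in `c`. By `hdvd` its image `k + m` has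
    -- such a level in `e`, and the two vertices compare the base points.
    have h2 : (2 : ℤ) ^ (N + 1) ∣ (-τ) % 2 ^ (N + 1) + τ := by
      have := Int.dvd_sub_self_of_emod_eq (a := -τ) (b := 2 ^ (N + 1)) rfl
      obtain ⟨x, hx⟩ := this
      exact ⟨x, by linear_combination hx⟩
    obtain ⟨k, hk⟩ : ∃ k, k = (-τ) % 2 ^ (N + 1) := ⟨_, rfl⟩
    rw [← hk] at h0 h1 h2
    have g1 := (h.mem_seqE_iff (N + 1) le_rfl k).mp ((hσ.mem_seqE_iff (by omega) k).mpr h2)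
    have g2 := (h'.mem_seqE_iff (N + 1) le_rfl (k + m)).mp
      ((hσ'.mem_seqE_iff (by omega) (k + m)).mpr (by
        rw [show k + m + τ' = k + τ + (m + τ' - τ) by ring]
        exact dvd_add h2 hdvd))
    rw [hterm k h0 (by omega)] at g2
    have := dvd_sub g2 g1
    convert this using 1; ring
  refine ⟨hz, ?_⟩
  intro n hn
  -- a position of level exactly `n`
  have hpn : (0 : ℤ) < 2 ^ (n + 1) := by positivity
  have hle : (2 : ℤ) ^ (n + 1) ≤ 2 ^ (N + 1) := pow_le_pow_right₀ (by norm_num) (by omega)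
  have h1 : (2 ^ n - τ) % 2 ^ (n + 1) < 2 ^ (n + 1) := Int.emod_lt_of_pos _ hpn
  have h0 : 0 ≤ (2 ^ n - τ) % 2 ^ (n + 1) := Int.emod_nonneg _ hpn.ne'
  obtain ⟨q, hq⟩ : ∃ q : ℤ, (2 ^ n - τ) % 2 ^ (n + 1) + τ = 2 ^ n * (2 * q + 1) := by
    refine ⟨-((2 ^ n - τ) / 2 ^ (n + 1)), ?_⟩
    have := Int.emod_add_mul_ediv (2 ^ n - τ) (2 ^ (n + 1))
    rw [pow_succ] at this ⊢
    linear_combination this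
  obtain ⟨k, hk⟩ : ∃ k, k = (2 ^ n - τ) % 2 ^ (n + 1) := ⟨_, rfl⟩
  rw [← hk] at h0 h1 hq
  have g1 := (h.mem_seqE_iff n (by omega) k).mp
    ((hσ.mem_seqE_iff (by omega) k).mpr (by rw [hq]; exact dvd_mul_right _ _))
  have g2 := mt (h.mem_seqE_iff (n + 1) (by omega) k).mpr
    (mt (hσ.mem_seqE_iff (by omega) k).mp (by rw [hq]; exact not_pow_two_dvd (by omega) q))
  obtain ⟨w, hw⟩ := g1
  rw [hw] at g2
  have hodd := odd_of_not_dvd g2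
  have hw1 : (c.segAt k).term = z + oneAddI ^ n * w := by rw [← hw]; ring
  obtain ⟨w', hw', hww'⟩ := exists_add_pow_mul hn hz w
  have hodd' := odd_of_sub_dvd ((Dvd.intro _ (sq oneAddI).symm).trans hww') hodd
  have t1 := h.turn_eq n (by omega) k w hodd hw1
  have t2 := h'.turn_eq n (by omega) (k + m) w' hodd' (by
    rw [hterm k h0 (by omega), hw1, ← hw']; ring)
  rw [← hab k h0 (by omega), t1, altSign_eq_of_dvd hww', mul_left_inj] at t2
  exact t2

/-- One level is lost: the turn at level `n` depends on `w` modulo `(1 + i) ^ 2`, hence on the base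
point modulo `(1 + i) ^ (n + 2)`. -/
theorem Curve.IsHierarchical.change_base {c : Curve} {a : ℤ → ℤˣ} {N : ℕ} {z z' : GaussianInt}
    {s s' : ℕ → ℤˣ} (h : c.IsHierarchical a (N + 1) z s) (hz : oneAddI ^ (N + 1) ∣ z' - z)
    (hs : ∀ n < N, s n = s' n) : c.IsHierarchical a N z' s' := by
  constructor
  · intro n hn k
    rw [h.mem_seqE_iff n (by omega)]
    have h1 : oneAddI ^ n ∣ z' - z := (pow_dvd_pow _ (by omega)).trans hz
    rw [← dvd_sub_left h1]
    · congr! 1; ring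
  · intro n hn k w hw hk
    obtain ⟨w', hw', hww'⟩ := exists_add_pow_mul hn hz w
    have hodd' := odd_of_sub_dvd ((Dvd.intro _ (sq oneAddI).symm).trans hww') hw
    rw [h.turn_eq n (by omega) k w' hodd' (hk.trans hw'), altSign_eq_of_dvd hww', hs n hn]

/-! ### Translates, and pairs of blocks in a covering -/

theorem Curve.translate_translate (u v : GaussianInt) (c : Curve) :
    (c.translate v).translate u = c.translate (u + v) := by
  unfold Curve.translate
  congr 1
  funext k
  exact Seg.translate_translate u v _

theorem Curve.translate_zero (c : Curve) : c.translate 0 = c := by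
  unfold Curve.translate
  congr 1
  funext k
  exact Seg.translate_zero _

theorem translateSet_translateSet (u v : GaussianInt) (B : Set Curve) :
    translateSet u (translateSet v B) = translateSet (u + v) B := by
  simp only [translateSet, Set.image_image, Curve.translate_translate]

theorem translateSet_zero (B : Set Curve) : translateSet 0 B = B := by
  simp [translateSet, Curve.translate_zero]

theorem isCopy_iff {F B : Set Curve} : IsCopy F B ↔ ∃ u, F = translateSet u B := by
  constructor
  · rintro ⟨u, rfl⟩
    exact ⟨-u, by rw [translateSet_translateSet, neg_add_cancel, translateSet_zero]⟩
  · rintro ⟨u, rfl⟩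
    exact ⟨-u, by rw [translateSet_translateSet, neg_add_cancel, translateSet_zero]⟩

theorem Seg.translate_injective (u : GaussianInt) : Function.Injective (Seg.translate u) := by
  intro A B h
  have := congrArg (Seg.translate (-u)) h
  simpa [Seg.translate_translate, Seg.translate_zero] using this

theorem mem_segsOf_translateSet {u : GaussianInt} {B : Set Curve} {A : Seg} :
    A ∈ segsOf (translateSet u B) ↔ ∃ A' ∈ segsOf B, A = A'.translate u := by
  constructor
  · rintro ⟨_, ⟨c, hc, rfl⟩, k, rfl⟩
    exact ⟨c.seg k, ⟨c, hc, k, rfl⟩, rfl⟩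
  · rintro ⟨_, ⟨c, hc, k, rfl⟩, rfl⟩
    exact ⟨_, ⟨c, hc, rfl⟩, k, rfl⟩

theorem IsCovering.eq_of_edge_eq {C : Set Curve} (hC : IsCovering C) {c d : Curve} (hc : c ∈ C)
    (hd : d ∈ C) {k l : ℤ} (h : (c.segAt k).edge = (d.segAt l).edge) : c = d ∧ k = l := by
  have hcd : c = d := by
    by_contra hne
    exact hC.system.disjoint c hc d hd hne _ (c.segAt_mem ((hC.complete c hc).mem k)) _
      (d.segAt_mem ((hC.complete d hd).mem l)) h
  subst hcd
  refine ⟨rfl, ?_⟩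
  rw [c.segAt_eq ((hC.complete c hc).mem k), c.segAt_eq ((hC.complete c hc).mem l)] at h
  simpa using hC.system.selfAvoiding c hc h

theorem IsCovering.exists_edge_eq {C : Set Curve} (hC : IsCovering C) (A : Seg) :
    ∃ c ∈ C, ∃ k, (c.segAt k).edge = A.edge := by
  have key : ∀ (z : GaussianInt) (ε : GaussianIntˣ), ε = 1 ∨ ε = iUnit →
      A.edge = s(z, z + (ε : GaussianInt)) → ∃ c ∈ C, ∃ k, (c.segAt k).edge = A.edge := by
    intro z ε hε hA
    obtain ⟨⟨c, k⟩, ⟨hc, hk⟩, -⟩ := hC.covers z ε hε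
    exact ⟨c, hc, k, by rw [c.segAt_coe, hk, hA]⟩
  rcases unit_eq A.dir with h | h | h | h
  · exact key A.init 1 (Or.inl rfl) (by simp [Seg.edge, Seg.term, h])
  · exact key A.term 1 (Or.inl rfl) (by rw [Seg.edge, Sym2.eq_swap]; simp [Seg.term, h])
  · exact key A.init iUnit (Or.inr rfl) (by simp [Seg.edge, Seg.term, h])
  · exact key A.term iUnit (Or.inr rfl) (by
      rw [Seg.edge, Sym2.eq_swap, Seg.term, h, Units.val_neg, neg_add_cancel_right])

theorem IsCovering.nonempty {C : Set Curve} (hC : IsCovering C) : C.Nonempty := by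
  obtain ⟨c, hc, -⟩ := hC.exists_edge_eq ⟨0, 1⟩
  exact ⟨c, hc⟩

/-- The block of the segments of index `0, …, l` of a complete curve. -/
noncomputable def Curve.block (c : Curve) (hc : c.IsComplete) (l : ℕ) : Curve where
  idx := Set.Icc 0 l
  idx_nonempty := ⟨0, by simp⟩
  idx_ordConnected := Set.ordConnected_Icc
  seg k := c.segAt k
  term_eq_init k k' h := by rw [hc.term_eq, h]
  turns k k' h := by
    rw [h, c.segAt_eq (hc.mem k), c.segAt_eq (hc.mem (k + 1))]
    exact c.turns _ _ rfl

theorem Curve.mem_segs_block {c : Curve} {hc : c.IsComplete} {l : ℕ} {A : Seg} :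
    A ∈ (c.block hc l).segs ↔ ∃ k : ℤ, 0 ≤ k ∧ k ≤ l ∧ c.segAt k = A := by
  constructor
  · rintro ⟨⟨k, h0, h1⟩, rfl⟩
    exact ⟨k, h0, h1, rfl⟩
  · rintro ⟨k, h0, h1, rfl⟩
    exact ⟨⟨k, h0, h1⟩, rfl⟩

theorem Seg.isBounded_support (A : Seg) : Bornology.IsBounded A.support := by
  unfold Seg.support
  rw [← convexHull_pair, isBounded_convexHull]
  exact (Set.toFinite _).isBounded

theorem IsCoherentlyOriented.mono {B C : Set Curve} (h : IsCoherentlyOriented C)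
    (hBC : segsOf B ⊆ segsOf C) : IsCoherentlyOriented B := by
  refine h.imp ?_ ?_ <;> intro h z <;>
    exact ⟨fun hz A hA => (h z).1 hz A (hBC hA), fun hz A hA => (h z).2 hz A (hBC hA)⟩

section Blocks

variable {C : Set Curve} {c e : Curve}

theorem IsCovering.segsOf_blocks (hC : IsCovering C) (hc : c ∈ C) (he : e ∈ C) (l : ℕ) {A : Seg}
    (hA : A ∈ segsOf {c.block (hC.complete c hc) l, e.block (hC.complete e he) l}) :
    ∃ d ∈ C, (d = c ∨ d = e) ∧ ∃ k : ℤ, 0 ≤ k ∧ k ≤ l ∧ d.segAt k = A := by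
  obtain ⟨p, rfl | rfl, hA⟩ := hA
  · exact ⟨c, hc, Or.inl rfl, Curve.mem_segs_block.mp hA⟩
  · exact ⟨e, he, Or.inr rfl, Curve.mem_segs_block.mp hA⟩

theorem IsCovering.segsOf_blocks_subset (hC : IsCovering C) (hc : c ∈ C) (he : e ∈ C) (l : ℕ) :
    segsOf {c.block (hC.complete c hc) l, e.block (hC.complete e he) l} ⊆ segsOf C := by
  intro A hA
  obtain ⟨d, hd, -, k, -, -, rfl⟩ := hC.segsOf_blocks hc he l hA
  exact ⟨d, hd, d.segAt_mem ((hC.complete d hd).mem k)⟩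

theorem IsCovering.isCurveSystem_blocks (hC : IsCovering C) (hc : c ∈ C) (he : e ∈ C) (l : ℕ)
    (hce : c ≠ e) :
    IsCurveSystem {c.block (hC.complete c hc) l, e.block (hC.complete e he) l} := by
  constructor
  · rintro p (rfl | rfl)
    · intro k k' h
      exact Subtype.ext (hC.eq_of_edge_eq hc hc h).2
    · intro k k' h
      exact Subtype.ext (hC.eq_of_edge_eq he he h).2
  · rintro p (rfl | rfl) q (rfl | rfl) hpq A ⟨k, rfl⟩ A' ⟨k', rfl⟩ h
    · exact hpq rfl
    · exact hce (hC.eq_of_edge_eq hc he h).1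
    · exact hce (hC.eq_of_edge_eq he hc h).1.symm
    · exact hpq rfl
  · exact hC.system.oriented.mono (hC.segsOf_blocks_subset hc he l)

theorem IsCovering.isBoundedSystem_blocks (hC : IsCovering C) (hc : c ∈ C) (he : e ∈ C) (l : ℕ) :
    IsBoundedSystem {c.block (hC.complete c hc) l, e.block (hC.complete e he) l} := by
  have : supportOf {c.block (hC.complete c hc) l, e.block (hC.complete e he) l} ⊆
      ⋃ k ∈ Set.Icc (0 : ℤ) l, ((c.segAt k).support ∪ (e.segAt k).support) := by
    rintro x ⟨A, hA, hx⟩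
    obtain ⟨d, -, hd, k, h0, h1, rfl⟩ := hC.segsOf_blocks hc he l hA
    simp only [Set.mem_iUnion]
    rcases hd with rfl | rfl
    · exact ⟨k, ⟨h0, h1⟩, Or.inl hx⟩
    · exact ⟨k, ⟨h0, h1⟩, Or.inr hx⟩
  refine Bornology.IsBounded.subset ?_ this
  rw [Bornology.isBounded_biUnion (Set.finite_Icc _ _)]
  intro k _
  exact (Seg.isBounded_support _).union (Seg.isBounded_support _)

theorem IsCovering.below_blocks (hC : IsCovering C) (hc : c ∈ C) (he : e ∈ C) (l : ℕ)
    (hce : c ≠ e) :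
    Below {c.block (hC.complete c hc) l, e.block (hC.complete e he) l} C := by
  constructor
  · intro h
    have h1 : c.block (hC.complete c hc) l ∈ C := h.subset (Or.inl rfl)
    have h2 : (-1 : ℤ) ∈ (c.block (hC.complete c hc) l).idx := (hC.complete _ h1).mem _
    have := h2.1
    omega
  · rintro p (rfl | rfl)
    · exact ⟨c, hc, 0, fun k => ⟨⟨k, (hC.complete c hc).mem _⟩, by simp, (c.segAt_coe _).symm⟩⟩
    · exact ⟨e, he, 0, fun k => ⟨⟨k, (hC.complete e he).mem _⟩, by simp, (e.segAt_coe _).symm⟩⟩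
  · rintro d hd A A' ⟨k, k', hk, rfl, rfl⟩ hA hA'
    obtain ⟨p, hp, hpce, i, i0, i1, hi⟩ := hC.segsOf_blocks hc he l hA
    obtain ⟨q, hq, hqce, j, j0, j1, hj⟩ := hC.segsOf_blocks hc he l hA'
    rw [← d.segAt_coe] at hi hj
    obtain ⟨rfl, rfl⟩ := hC.eq_of_edge_eq hp hd (congrArg Seg.edge hi)
    obtain ⟨rfl, rfl⟩ := hC.eq_of_edge_eq hq hd (congrArg Seg.edge hj)
    rcases hpce with rfl | rfl
    · exact ⟨_, Or.inl rfl, ⟨k, i0, i1⟩, ⟨k', j0, j1⟩, hk, q.segAt_coe k, q.segAt_coe k'⟩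
    · exact ⟨_, Or.inr rfl, ⟨k, i0, i1⟩, ⟨k', j0, j1⟩, hk, q.segAt_coe k, q.segAt_coe k'⟩

end Blocks

/-! ### A common hierarchy for the whole covering -/

/-- A curve that contains all the edges in a diamond also contains the curves of the covering
which meet the diamond. -/
theorem IsCovering.eq_of_init_mem_double {C : Set Curve} (hC : IsCovering C) {d e : Curve}
    (hd : d ∈ C) (he : e ∈ C) {b : ℤ → ℤˣ} (hb : e.IsAssociatedTo b) (τ : ℤ) {k : ℤ}
    (h : (d.segAt k).init ∈ doublePoints fun t => (e.segAt (t - τ + 1)).init) : d = e := by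
  have hw := (hC.complete e he).isWalk hb τ
  have hinj : ∀ t t' : ℤ, (e.segAt (t - τ + 1)).init = (e.segAt (t' - τ + 1)).init →
      (e.segAt (t - τ + 1)).dir = (e.segAt (t' - τ + 1)).dir → t = t' := by
    intro t t' h1 h2
    have := (hC.eq_of_edge_eq he he (congrArg Seg.edge (Seg.ext h1 h2))).2
    omega
  obtain ⟨t, ht, hD | hD⟩ := hw.exists_edge_of_double hinj h (d.segAt k).dir
  · exact (hC.eq_of_edge_eq he hd (congrArg Seg.edge (Seg.ext ht hD))).1.symm
  · refine (hC.eq_of_edge_eq he hd (k := t - 1 - τ + 1) (l := k)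
      ((Seg.edge_eq_iff _ _).mpr (Or.inr ⟨?_, hD⟩))).1.symm
    have h1 : (e.segAt (t - 1 - τ + 1)).term = (e.segAt (t - τ + 1)).init := by
      rw [(hC.complete e he).term_eq]; congr 2; ring
    rw [ht] at h1
    unfold Seg.term at h1 ⊢
    rw [hD] at h1
    push_cast at h1
    linear_combination h1

theorem toComplex_init_mem_support (A : Seg) : GaussianInt.toComplex A.init ∈ A.support :=
  left_mem_segment _ _ _

theorem toComplex_term_mem_support (A : Seg) : GaussianInt.toComplex A.term ∈ A.support :=
  right_mem_segment _ _ _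

/-- In a covering which satisfies the local isomorphism property, some translation maps given
blocks of two curves into one of them. -/
theorem LocalIsomorphismProperty.exists_translate {C : Set Curve}
    (hloc : LocalIsomorphismProperty C) (hC : IsCovering C)
    (hfold : ∀ c ∈ C, c.IsCompleteFolding) {c e : Curve} (hc : c ∈ C) (he : e ∈ C) (hce : c ≠ e)
    (l : ℕ) : ∃ (u : GaussianInt) (m m' : ℤ), ∀ k : ℤ, 0 ≤ k → k ≤ l →
      e.segAt (k + m) = (c.segAt k).translate u ∧
      e.segAt (k + m') = (e.segAt k).translate u := by
  obtain ⟨r, hr⟩ := hloc _ (hC.isCurveSystem_blocks hc he l hce)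
    (hC.isBoundedSystem_blocks hc he l) (hC.below_blocks hc he l hce)
  -- Lattice points of a ball of radius `r` lie in the diamond of radius `2 * r < n < 2 ^ n` with
  -- the same centre.
  obtain ⟨n, hn⟩ := exists_nat_gt (2 * r)
  obtain ⟨-, b, hbfold, hb⟩ := hfold e he
  obtain ⟨τ, σ, hσ⟩ := hbfold.exists_toeplitz (2 * n + 7)
  have hw := (hC.complete e he).isWalk hb τ
  have hinj : ∀ t t' : ℤ, (e.segAt (t - τ + 1)).init = (e.segAt (t' - τ + 1)).init →
      (e.segAt (t - τ + 1)).dir = (e.segAt (t' - τ + 1)).dir → t = t' := by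
    intro t t' h1 h2
    have := (hC.eq_of_edge_eq he he (congrArg Seg.edge (Seg.ext h1 h2))).2
    omega
  obtain ⟨v, hv⟩ := hw.exists_diamond_double n hinj hσ
  obtain ⟨F, hF, hcopy, hball⟩ := hr (GaussianInt.toComplex v)
  obtain ⟨u, rfl⟩ := isCopy_iff.mp hcopy
  have key : ∀ p ∈ C, (p = c ∨ p = e) → ∃ m : ℤ, ∀ k : ℤ, 0 ≤ k → k ≤ l →
      e.segAt (k + m) = (p.segAt k).translate u := by
    intro p hp hpce
    have hmem : (p.block (hC.complete p hp) l).translate u ∈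
        translateSet u {c.block (hC.complete c hc) l, e.block (hC.complete e he) l} := by
      refine ⟨_, ?_, rfl⟩
      rcases hpce with rfl | rfl
      · exact Or.inl rfl
      · exact Or.inr rfl
    obtain ⟨d, hd, m, hm⟩ := hF.contained _ hmem
    have hm' : ∀ k : ℤ, 0 ≤ k → k ≤ l → d.segAt (k + m) = (p.segAt k).translate u := by
      intro k h0 h1
      obtain ⟨i, hi, hi'⟩ := hm ⟨k, h0, h1⟩
      rw [← d.segAt_coe, hi] at hi'
      exact hi'
    -- The copy of the block starts in the diamond of points which `e` visits twice, so the curve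
    -- that contains it can only be `e`.
    have hde : d = e := by
      refine hC.eq_of_init_mem_double hd he hb τ (k := 0 + m) ?_
      have hsup : GaussianInt.toComplex (d.segAt (0 + m)).init ∈
          Metric.closedBall (GaussianInt.toComplex v) r := by
        refine hball ⟨d.segAt (0 + m), ?_, toComplex_init_mem_support _⟩
        rw [hm' 0 le_rfl (by omega)]
        exact ⟨_, hmem, ⟨0, by simp [Curve.block, Curve.translate]⟩, rfl⟩
      generalize (d.segAt (0 + m)).init = x at hsup ⊢
      rw [mem_closedBall_iff_norm, ← map_sub] at hsup
      have h1 := (Complex.abs_re_le_norm _).trans hsup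
      have h2 := (Complex.abs_im_le_norm _).trans hsup
      rw [← GaussianInt.intCast_re] at h1
      rw [← GaussianInt.intCast_im] at h2
      have h3 : |(x - v).re| + |(x - v).im| ≤ (2 : ℤ) ^ n := by
        have h4 : ((|(x - v).re| + |(x - v).im| : ℤ) : ℝ) < ((2 : ℤ) ^ n : ℤ) := by
          push_cast
          have : (n : ℝ) < 2 ^ n := by exact_mod_cast Nat.lt_two_pow_self
          linarith
        exact (Int.cast_lt.mp h4).le
      convert hv _ _ h3 using 1
      ext <;> simp
    subst hde
    exact ⟨m, hm'⟩
  obtain ⟨m, hm⟩ := key c hc (Or.inl rfl)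
  obtain ⟨m', hm'⟩ := key e he (Or.inr rfl)
  exact ⟨u, m, m', fun k h0 h1 => ⟨hm k h0 h1, hm' k h0 h1⟩⟩

/-- The curves of a covering which satisfies the local isomorphism property have a common
hierarchy. -/
theorem IsCovering.exists_isHierarchical {C : Set Curve} (hC : IsCovering C)
    (hfold : ∀ c ∈ C, c.IsCompleteFolding) (hloc : LocalIsomorphismProperty C) (N : ℕ) :
    ∃ (z : GaussianInt) (s : ℕ → ℤˣ), ∀ c ∈ C, ∀ a, c.IsAssociatedTo a →
      c.IsHierarchical a N z s := by
  obtain ⟨e, he⟩ := hC.nonempty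
  have hec := hC.complete e he
  obtain ⟨-, b, hbfold, hb⟩ := hfold e he
  obtain ⟨τ', σ', hσ'⟩ := hbfold.exists_toeplitz (N + 2)
  obtain ⟨z, s, hz⟩ := hec.exists_isHierarchical hb hσ'
  refine ⟨z, s, fun c hc a ha => ?_⟩
  by_cases hce : c = e
  · subst hce
    rw [hec.associated_unique ha hb]
    exact hz.change_base (by simp) (by simp)
  have hcc := hC.complete c hc
  obtain ⟨-, a', hafold, ha'⟩ := hfold c hc
  obtain rfl := hcc.associated_unique ha' ha
  obtain ⟨τ, σ, hσ⟩ := hafold.exists_toeplitz (N + 2)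
  obtain ⟨z', s', hz'⟩ := hcc.exists_isHierarchical ha hσ
  obtain ⟨u, m, m', hu⟩ := hloc.exists_translate hC hfold hc he hce (2 ^ (N + 4) + 1)
  push_cast at hu
  -- The same translation `u` moves both blocks into `e`: the first comparison gives `z' + u ≡ z`,
  -- the second `z + u ≡ z`, and `u` cancels.
  obtain ⟨g1, hs⟩ := hz'.compare hcc hec ha hb hσ hσ' hz fun k h0 h1 => (hu k h0 h1).1
  obtain ⟨g2, -⟩ := hz.compare hec hec hb hb hσ' hσ' hz fun k h0 h1 => (hu k h0 h1).2
  refine hz'.change_base ?_ hs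
  have := dvd_sub g2 g1
  convert this using 1
  ring

/-! ### Invariance of the covering away from the vertices of high level -/

/-- `A` and `B` are consecutive segments of a curve of `C`. -/
def ConsecutiveIn (C : Set Curve) (A B : Seg) : Prop := ∃ c ∈ C, c.Consecutive A B

theorem Curve.IsComplete.consecutive_iff {c : Curve} (hc : c.IsComplete) {A B : Seg} :
    c.Consecutive A B ↔ ∃ k, c.segAt k = A ∧ c.segAt (k + 1) = B := by
  constructor
  · rintro ⟨k, l, hkl, rfl, rfl⟩
    exact ⟨k, c.segAt_coe k, by rw [← hkl]; exact c.segAt_coe l⟩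
  · rintro ⟨k, rfl, rfl⟩
    exact ⟨⟨k, hc.mem _⟩, ⟨k + 1, hc.mem _⟩, rfl, (c.segAt_eq _).symm, (c.segAt_eq _).symm⟩

theorem consecutiveIn_translateSet {u : GaussianInt} {B : Set Curve} {A A' : Seg} :
    ConsecutiveIn (translateSet u B) A A' ↔
      ∃ D D', ConsecutiveIn B D D' ∧ A = D.translate u ∧ A' = D'.translate u := by
  constructor
  · rintro ⟨_, ⟨c, hc, rfl⟩, k, l, hkl, rfl, rfl⟩
    exact ⟨c.seg k, c.seg l, ⟨c, hc, k, l, hkl, rfl, rfl⟩, rfl, rfl⟩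
  · rintro ⟨_, _, ⟨c, hc, k, l, hkl, rfl, rfl⟩, rfl, rfl⟩
    exact ⟨_, ⟨c, hc, rfl⟩, k, l, hkl, rfl, rfl⟩

theorem IsCovering.mem_segsOf_iff {C : Set Curve} (hC : IsCovering C) {A : Seg} :
    A ∈ segsOf C ↔ ∃ c ∈ C, ∃ k, c.segAt k = A := by
  constructor
  · rintro ⟨c, hc, k, rfl⟩
    exact ⟨c, hc, k, c.segAt_coe k⟩
  · rintro ⟨c, hc, k, rfl⟩
    exact ⟨c, hc, c.segAt_mem ((hC.complete c hc).mem k)⟩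

theorem IsCovering.consecutiveIn_iff {C : Set Curve} (hC : IsCovering C) {A B : Seg} :
    ConsecutiveIn C A B ↔ ∃ c ∈ C, ∃ k, c.segAt k = A ∧ c.segAt (k + 1) = B := by
  constructor
  · rintro ⟨c, hc, h⟩
    exact ⟨c, hc, (hC.complete c hc).consecutive_iff.mp h⟩
  · rintro ⟨c, hc, h⟩
    exact ⟨c, hc, (hC.complete c hc).consecutive_iff.mpr h⟩

theorem IsCovering.isContainedIn_of_consecutive {C : Set Curve} (hC : IsCovering C) {f : Curve}
    (hseg : f.segs ⊆ segsOf C) (hcons : ∀ A B, f.Consecutive A B → ConsecutiveIn C A B) :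
    ∃ d ∈ C, f.IsContainedIn d := by
  obtain ⟨k₀, hk₀⟩ := f.idx_nonempty
  obtain ⟨d, hd, l₀, hl₀⟩ := hC.mem_segsOf_iff.mp (hseg (f.segAt_mem hk₀))
  have hstep : ∀ k, k ∈ f.idx → k + 1 ∈ f.idx →
      (d.segAt (k + (l₀ - k₀)) = f.segAt k ↔ d.segAt (k + 1 + (l₀ - k₀)) = f.segAt (k + 1)) := by
    intro k hk hk'
    obtain ⟨c, hc, l, h1, h2⟩ := hC.consecutiveIn_iff.mp (hcons (f.segAt k) (f.segAt (k + 1))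
      ⟨⟨k, hk⟩, ⟨k + 1, hk'⟩, rfl, (f.segAt_eq _).symm, (f.segAt_eq _).symm⟩)
    constructor
    · intro h
      obtain ⟨rfl, rfl⟩ := hC.eq_of_edge_eq hc hd (congrArg Seg.edge (h1.trans h.symm))
      rw [← h2]; congr 1; ring
    · intro h
      obtain ⟨rfl, h3⟩ := hC.eq_of_edge_eq hc hd (congrArg Seg.edge (h2.trans h.symm))
      rw [← h1]; congr 1; omega
  refine ⟨d, hd, l₀ - k₀, ?_⟩
  rintro ⟨k, hk⟩
  refine ⟨⟨k + (l₀ - k₀), (hC.complete d hd).mem _⟩, rfl, ?_⟩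
  rw [← d.segAt_coe, ← f.segAt_coe]
  dsimp only
  rcases le_total k₀ k with hle | hle
  · induction k, hle using Int.leInduction with
    | base => rw [hl₀.symm]; congr 1; ring
    | succ k hle ih =>
      have hk' : k ∈ f.idx := f.idx_ordConnected.out hk₀ hk ⟨hle, by omega⟩
      exact (hstep k hk' hk).mp (ih hk')
  · induction k, hle using Int.leInductionDown with
    | base => rw [hl₀.symm]; congr 1; ring
    | pred k hle ih =>
      have hk' : k ∈ f.idx := f.idx_ordConnected.out hk hk₀ ⟨by omega, hle⟩
      have := hstep (k - 1) hk (by simpa using hk')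
      rw [sub_add_cancel] at this
      exact this.mpr (ih hk')

/-- This reduces `Below` to local data on segments and pairs of consecutive segments, for which
translates are easy to test. -/
theorem IsCovering.below_iff {C : Set Curve} (hC : IsCovering C) {F : Set Curve} :
    Below F C ↔ F ≠ C ∧ segsOf F ⊆ segsOf C ∧
      ∀ A ∈ segsOf F, ∀ B ∈ segsOf F, ConsecutiveIn C A B ↔ ConsecutiveIn F A B := by
  constructor
  · intro h
    refine ⟨h.ne, ?_, ?_⟩
    · rintro _ ⟨f, hf, k, rfl⟩
      obtain ⟨d, hd, m, hm⟩ := h.contained f hf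
      obtain ⟨l, -, hl⟩ := hm k
      exact ⟨d, hd, l, hl⟩
    · intro A hA B hB
      constructor
      · rintro ⟨d, hd, hdAB⟩
        exact h.consecutive d hd A B hdAB hA hB
      · rintro ⟨f, hf, k, l, hkl, rfl, rfl⟩
        obtain ⟨d, hd, m, hm⟩ := h.contained f hf
        obtain ⟨k', hk', hk''⟩ := hm k
        obtain ⟨l', hl', hl''⟩ := hm l
        exact ⟨d, hd, k', l', by omega, hk'', hl''⟩
  · rintro ⟨h1, h2, h3⟩
    refine ⟨h1, ?_, ?_⟩
    · intro f hf
      refine hC.isContainedIn_of_consecutive (fun A hA => h2 ⟨f, hf, hA⟩) ?_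
      intro A B hAB
      obtain ⟨k, l, -, rfl, rfl⟩ := id hAB
      exact (h3 _ ⟨f, hf, k, rfl⟩ _ ⟨f, hf, l, rfl⟩).mpr ⟨f, hf, hAB⟩
    · intro d hd A B hAB hA hB
      exact (h3 A hA B hB).mp ⟨d, hd, hAB⟩

theorem IsCoherentlyOriented.exists_iff {C : Set Curve} (h : IsCoherentlyOriented C) :
    ∃ P : Prop, ∀ A ∈ segsOf C, (Even (A.init.re + A.init.im) ↔ (IsHor A.dir ↔ P)) := by
  have hv : ∀ A : Seg, A.IsVertical → ¬ IsHor A.dir := by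
    rintro A (h | h) <;> rw [h] <;> decide
  rcases h with h | h
  · refine ⟨True, fun A hA => ?_⟩
    by_cases he : Even (A.init.re + A.init.im)
    · have hh : IsHor A.dir := (((h A.init).1 he) A hA).1 rfl
      simpa [he] using hh
    · simpa [he] using hv A ((((h A.init).2 (Int.not_even_iff_odd.mp he)) A hA).1 rfl)
  · refine ⟨False, fun A hA => ?_⟩
    by_cases he : Even (A.init.re + A.init.im)
    · simpa [he] using hv A ((((h A.init).1 he) A hA).1 rfl)
    · have hh : IsHor A.dir := (((h A.init).2 (Int.not_even_iff_odd.mp he)) A hA).1 rfl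
      simpa [he] using hh

/-- The covering uses the translated edge in some orientation. By coherence the axis of a segment
determines the parity of its initial point; reversal preserves the axis and changes that parity,
whereas multiples of `1 + i` preserve both. -/
theorem IsCovering.translate_mem_segsOf {C : Set Curve} (hC : IsCovering C) {g : GaussianInt}
    (hg : oneAddI ∣ g) {A : Seg} (hA : A ∈ segsOf C) : A.translate g ∈ segsOf C := by
  obtain ⟨P, hP⟩ := hC.system.oriented.exists_iff
  obtain ⟨c, hc, k, hk⟩ := hC.exists_edge_eq (A.translate g)
  have hmem := hC.mem_segsOf_iff.mpr ⟨c, hc, k, rfl⟩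
  rcases (Seg.edge_eq_iff _ _).mp hk with h | ⟨h1, h2⟩
  · rwa [← h]
  · exfalso
    have e1 := hP A hA
    have e2 := hP _ hmem
    rw [oneAddI_dvd_iff] at hg
    have hodd := odd_unit A.dir
    have hhor : IsHor (-A.dir) ↔ IsHor A.dir := by
      rcases unit_eq A.dir with h | h | h | h <;> rw [h] <;> decide
    rw [h1, h2, Seg.term_translate] at e2
    change _ ↔ (IsHor (-A.dir) ↔ P) at e2
    rw [hhor, ← e1] at e2
    simp only [Seg.term, Zsqrtd.re_add, Zsqrtd.im_add] at e2
    rw [← Int.not_even_iff_odd] at hodd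
    rw [show g.re + (A.init.re + (A.dir : GaussianInt).re) +
      (g.im + (A.init.im + (A.dir : GaussianInt).im)) = (g.re + g.im) +
      (A.init.re + A.init.im) + ((A.dir : GaussianInt).re + (A.dir : GaussianInt).im) by ring,
      Int.even_add, Int.even_add] at e2
    tauto

section Hierarchy

variable {C : Set Curve} {N : ℕ} {z : GaussianInt} {s : ℕ → ℤˣ}

theorem exists_eq_pow_mul_odd {n : ℕ} {g : GaussianInt} (h : ¬ oneAddI ^ n ∣ g) :
    ∃ j < n, ∃ w : GaussianInt, Odd (w.re + w.im) ∧ g = oneAddI ^ j * w := by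
  induction n generalizing g with
  | zero => simp at h
  | succ n ih =>
    by_cases hd : oneAddI ∣ g
    · obtain ⟨g', rfl⟩ := hd
      obtain ⟨j, hj, w, hw, rfl⟩ := ih (g := g') fun hd => h (by
        rw [pow_succ']; exact mul_dvd_mul_left _ hd)
      exact ⟨j + 1, by omega, w, hw, by ring⟩
    · refine ⟨0, by omega, g, ?_, by simp⟩
      rwa [oneAddI_dvd_iff, Int.not_even_iff_odd] at hd

/-- Away from the vertices of high level, the covering is invariant by the translations of high
level. -/
theorem IsCovering.consecutiveIn_translate (hC : IsCovering C)
    (hfold : ∀ c ∈ C, c.IsCompleteFolding)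
    (hz : ∀ c ∈ C, ∀ a, c.IsAssociatedTo a → c.IsHierarchical a N z s) {g : GaussianInt}
    (hg : oneAddI ^ (N + 1) ∣ g) {A B : Seg} (hA : ¬ oneAddI ^ N ∣ A.term - z)
    (h : ConsecutiveIn C A B) : ConsecutiveIn C (A.translate g) (B.translate g) := by
  obtain ⟨c, hc, k, rfl, rfl⟩ := hC.consecutiveIn_iff.mp h
  have hmem := hC.translate_mem_segsOf ((dvd_pow_self _ (by omega)).trans hg)
    (hC.mem_segsOf_iff.mpr ⟨c, hc, k, rfl⟩)
  obtain ⟨d, hd, l, hl⟩ := hC.mem_segsOf_iff.mp hmem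
  refine hC.consecutiveIn_iff.mpr ⟨d, hd, l, hl, ?_⟩
  obtain ⟨-, a, -, ha⟩ := hfold c hc
  obtain ⟨-, b, -, hb⟩ := hfold d hd
  have hcc := hC.complete c hc
  have hdc := hC.complete d hd
  obtain ⟨n, hn, w, hw, hkw⟩ := exists_eq_pow_mul_odd hA
  have hab : a k = b l := by
    rw [sub_eq_iff_eq_add'] at hkw
    obtain ⟨w', hw', hww'⟩ := exists_add_pow_mul (z := z + g) (z' := z) hn (by simpa using hg) w
    have hodd' := odd_of_sub_dvd ((Dvd.intro _ (sq oneAddI).symm).trans hww') hw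
    rw [(hz c hc a ha).turn_eq n hn k w hw hkw, (hz d hd b hb).turn_eq n hn l w' hodd' ?_,
      altSign_eq_of_dvd hww']
    rw [hl, Seg.term_translate, hkw, ← hw']
    ring
  ext : 1
  · rw [← hdc.term_eq, hl, Seg.term_translate, hcc.term_eq]; rfl
  · rw [hdc.dir_eq hb, hl]
    change _ = (c.segAt (k + 1)).dir
    rw [hcc.dir_eq ha, hab]
    rfl

theorem IsCovering.below_translateSet (hC : IsCovering C)
    (hfold : ∀ c ∈ C, c.IsCompleteFolding)
    (hz : ∀ c ∈ C, ∀ a, c.IsAssociatedTo a → c.IsHierarchical a N z s) {g : GaussianInt}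
    (hg : oneAddI ^ (N + 1) ∣ g) {F : Set Curve} (hF : Below F C) (hne : translateSet g F ≠ C)
    (hv : ∀ v ∈ verticesOf F, ¬ oneAddI ^ N ∣ v - z) : Below (translateSet g F) C := by
  obtain ⟨-, h2, h3⟩ := hC.below_iff.mp hF
  refine hC.below_iff.mpr ⟨hne, ?_, ?_⟩
  · intro _ hA
    obtain ⟨A, hA', rfl⟩ := mem_segsOf_translateSet.mp hA
    exact hC.translate_mem_segsOf ((dvd_pow_self _ (by omega)).trans hg) (h2 hA')
  · intro _ hA _ hB
    obtain ⟨A, hA', rfl⟩ := mem_segsOf_translateSet.mp hA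
    obtain ⟨B, hB', rfl⟩ := mem_segsOf_translateSet.mp hB
    have hAv : ¬ oneAddI ^ N ∣ A.term - z := hv _ ⟨A, hA', Or.inr rfl⟩
    have e1 : ConsecutiveIn C (A.translate g) (B.translate g) ↔ ConsecutiveIn C A B := by
      constructor
      · intro h
        have := hC.consecutiveIn_translate hfold hz (g := -g) (by simpa using hg) ?_ h
        · simpa [Seg.translate_translate, Seg.translate_zero] using this
        · rw [Seg.term_translate, add_sub_assoc, dvd_add_right ((pow_dvd_pow _ (by omega)).trans hg)]
          exact hAv
      · exact hC.consecutiveIn_translate hfold hz hg hAv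
    rw [e1, h3 A hA' B hB', consecutiveIn_translateSet]
    constructor
    · exact fun h => ⟨A, B, h, rfl, rfl⟩
    · rintro ⟨A', B', h, h1, h2⟩
      rwa [Seg.translate_injective g h1, Seg.translate_injective g h2]

end Hierarchy

/-! ### Vertices of bounded systems and of their translates -/

theorem verticesOf_translateSet {u : GaussianInt} {B : Set Curve} {v : GaussianInt} :
    v ∈ verticesOf (translateSet u B) ↔ ∃ w ∈ verticesOf B, v = u + w := by
  constructor
  · rintro ⟨_, hA, hv⟩
    obtain ⟨A, hA', rfl⟩ := mem_segsOf_translateSet.mp hA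
    rcases hv with rfl | rfl
    · exact ⟨A.init, ⟨A, hA', Or.inl rfl⟩, rfl⟩
    · exact ⟨A.term, ⟨A, hA', Or.inr rfl⟩, Seg.term_translate _ _⟩
  · rintro ⟨w, ⟨A, hA, rfl | rfl⟩, rfl⟩
    · exact ⟨_, mem_segsOf_translateSet.mpr ⟨A, hA, rfl⟩, Or.inl rfl⟩
    · exact ⟨_, mem_segsOf_translateSet.mpr ⟨A, hA, rfl⟩, Or.inr (Seg.term_translate _ _).symm⟩

theorem toComplex_mem_supportOf {B : Set Curve} {v : GaussianInt} (hv : v ∈ verticesOf B) :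
    GaussianInt.toComplex v ∈ supportOf B := by
  obtain ⟨A, hA, rfl | rfl⟩ := hv
  · exact ⟨A, hA, toComplex_init_mem_support A⟩
  · exact ⟨A, hA, toComplex_term_mem_support A⟩

theorem finite_verticesOf {B : Set Curve} (hB : IsBoundedSystem B) : (verticesOf B).Finite := by
  obtain ⟨R, hR⟩ := hB.subset_closedBall 0
  obtain ⟨n, hn⟩ := exists_nat_gt R
  have hfin : (Set.Icc (-n : ℤ) n ×ˢ Set.Icc (-n : ℤ) n).Finite :=
    (Set.finite_Icc _ _).prod (Set.finite_Icc _ _)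
  refine (hfin.image fun p => (⟨p.1, p.2⟩ : GaussianInt)).subset ?_
  intro v hv
  have h := hR (toComplex_mem_supportOf hv)
  rw [mem_closedBall_zero_iff] at h
  have h1 := (Complex.abs_re_le_norm _).trans h
  have h2 := (Complex.abs_im_le_norm _).trans h
  rw [← GaussianInt.intCast_re, abs_le] at h1
  rw [← GaussianInt.intCast_im, abs_le] at h2
  refine ⟨(v.re, v.im), ⟨⟨?_, ?_⟩, ?_, ?_⟩, rfl⟩ <;> dsimp only <;>
    · have : ∀ a b : ℤ, (a : ℝ) ≤ b → a ≤ b := fun a b => Int.cast_le.mp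
      apply this; push_cast; linarith

theorem nonempty_verticesOf {B : Set Curve} (hB : B.Nonempty) : (verticesOf B).Nonempty := by
  obtain ⟨c, hc⟩ := hB
  obtain ⟨k, hk⟩ := c.idx_nonempty
  exact ⟨_, c.seg ⟨k, hk⟩, ⟨c, hc, _, rfl⟩, Or.inl rfl⟩

theorem translateSet_inj {B : Set Curve} (hB : B.Nonempty) (hbdd : IsBoundedSystem B)
    {u u' : GaussianInt} (h : translateSet u B = translateSet u' B) : u = u' := by
  have hfin := finite_verticesOf hbdd
  have himg : ∀ u, verticesOf (translateSet u B) = (fun w => u + w) '' verticesOf B := by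
    intro u
    ext v
    rw [verticesOf_translateSet]
    simp only [Set.mem_image, eq_comm]
  -- Equal translates have the same vertex sum, and this sum contains the shift with the nonzero
  -- coefficient `card`.
  have hsum : ∑ v ∈ hfin.toFinset, (u + v) = ∑ v ∈ hfin.toFinset, (u' + v) := by
    have e : hfin.toFinset.image (fun w => u + w) = hfin.toFinset.image fun w => u' + w := by
      apply Finset.coe_injective
      simp only [Finset.coe_image, Set.Finite.coe_toFinset]
      rw [← himg, ← himg, h]
    have := congrArg (fun t => ∑ v ∈ t, v) e
    simpa only [Finset.sum_image (fun x _ y _ h => add_left_cancel h)] using this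
  rw [Finset.sum_add_distrib, Finset.sum_add_distrib, add_left_inj, Finset.sum_const,
    Finset.sum_const] at hsum
  have hne : hfin.toFinset.card ≠ 0 := by
    rw [Finset.card_ne_zero]
    simpa using nonempty_verticesOf hB
  rw [nsmul_eq_mul, nsmul_eq_mul] at hsum
  exact mul_left_cancel₀ (by exact_mod_cast hne) hsum

theorem IsCovering.translateSet_ne {C : Set Curve} (hC : IsCovering C) {B : Set Curve}
    (hbdd : IsBoundedSystem B) (u : GaussianInt) : translateSet u B ≠ C := by
  intro h
  have hfin : (verticesOf C).Finite := by
    rw [← h]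
    refine ((finite_verticesOf hbdd).image fun w => u + w).subset ?_
    intro v hv
    obtain ⟨w, hw, rfl⟩ := verticesOf_translateSet.mp hv
    exact ⟨w, hw, rfl⟩
  refine Set.infinite_of_injective_forall_mem (f := fun n : ℤ => (⟨n, 0⟩ : GaussianInt)) ?_ ?_ hfin
  · intro a b h
    exact congrArg Zsqrtd.re h
  · intro n
    obtain ⟨c, hc, k, hk⟩ := hC.exists_edge_eq ⟨⟨n, 0⟩, 1⟩
    have hmem := hC.mem_segsOf_iff.mpr ⟨c, hc, k, rfl⟩
    rcases (Seg.edge_eq_iff _ _).mp hk with h | ⟨h1, h2⟩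
    · exact ⟨_, hmem, Or.inl (by rw [h])⟩
    · refine ⟨_, hmem, Or.inr ?_⟩
      rw [Seg.term, h1, h2, Seg.term]
      simp

/-! ### Counting the points of periodic sets in squares -/

theorem sum_range_periodic {h : ℤ → ℕ} {M : ℕ} (hper : ∀ x, h (x + M) = h x) (a : ℤ) (k : ℕ) :
    ∑ i ∈ Finset.range (k * M), h (a + i) = k * ∑ i ∈ Finset.range M, h i := by
  have h1 : ∀ a : ℤ, ∑ i ∈ Finset.range M, h (a + i) = ∑ i ∈ Finset.range M, h i := by
    intro a
    have := int_const_of_succ (f := fun a : ℤ => ∑ i ∈ Finset.range M, h (a + i)) ?_ a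
    · simpa using this
    · intro a
      have e1 := Finset.sum_range_succ (fun i : ℕ => h (a + i)) M
      have e2 := Finset.sum_range_succ' (fun i : ℕ => h (a + i)) M
      rw [e1, hper] at e2
      push_cast at e2
      simp only [add_zero, add_left_inj] at e2
      rw [e2]
      refine Finset.sum_congr rfl fun i _ => ?_
      congr 1; ring
  induction k generalizing a with
  | zero => simp
  | succ k ih =>
    rw [add_mul, one_mul, Finset.sum_range_add, ih, add_mul, one_mul]
    congr 1
    rw [← h1 (a + (k * M : ℕ))]
    refine Finset.sum_congr rfl fun i _ => ?_
    congr 1; push_cast; ring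

/-- A half-open square with `n ^ 2` integer points. -/
def latticeBox (a b : ℤ) (n : ℕ) : Set GaussianInt :=
  {g | a ≤ g.re ∧ g.re < a + n ∧ b ≤ g.im ∧ g.im < b + n}

theorem finite_latticeBox (a b : ℤ) (n : ℕ) : (latticeBox a b n).Finite := by
  refine (((Set.finite_Icc a (a + n)).prod (Set.finite_Icc b (b + n))).image
    fun p => (⟨p.1, p.2⟩ : GaussianInt)).subset ?_
  rintro g ⟨h1, h2, h3, h4⟩
  exact ⟨(g.re, g.im), ⟨⟨h1, h2.le⟩, h3, h4.le⟩, rfl⟩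

open Classical in
theorem ncard_inter_latticeBox (P : Set GaussianInt) (a b : ℤ) (n : ℕ) :
    (P ∩ latticeBox a b n).ncard = ∑ i ∈ Finset.range n, ∑ j ∈ Finset.range n,
      if (⟨a + i, b + j⟩ : GaussianInt) ∈ P then 1 else 0 := by
  rw [← Finset.sum_product', ← Finset.card_filter]
  have hinj : Function.Injective fun p : ℕ × ℕ => (⟨a + p.1, b + p.2⟩ : GaussianInt) := by
    rintro ⟨i, j⟩ ⟨i', j'⟩ h
    have h1 := congrArg Zsqrtd.re h
    have h2 := congrArg Zsqrtd.im h
    simp at h1 h2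
    simp [h1, h2]
  rw [← Set.ncard_coe_finset, ← Set.ncard_image_of_injective _ hinj]
  congr 1
  ext g
  constructor
  · rintro ⟨hg, h1, h2, h3, h4⟩
    have e : (⟨a + ((g.re - a).toNat : ℤ), b + ((g.im - b).toNat : ℤ)⟩ : GaussianInt) = g := by
      ext <;> dsimp only <;> omega
    refine ⟨((g.re - a).toNat, (g.im - b).toNat), ?_, e⟩
    simp only [Finset.coe_filter, Finset.mem_product, Finset.mem_range, Set.mem_ofPred_eq, e]
    exact ⟨⟨by omega, by omega⟩, hg⟩
  · rintro ⟨p, hp, rfl⟩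
    simp only [Finset.coe_filter, Finset.mem_product, Finset.mem_range, Set.mem_ofPred_eq] at hp
    refine ⟨hp.2, ?_, ?_, ?_, ?_⟩ <;> dsimp only <;> omega

/-- Invariance under the translations of the lattice `M(ℤ + iℤ)`. -/
def IsPeriodicSet (M : ℕ) (P : Set GaussianInt) : Prop :=
  ∀ g ∈ P, ∀ h : GaussianInt, g + M * h ∈ P

theorem IsPeriodicSet.add_mem_iff {M : ℕ} {P : Set GaussianInt} (hP : IsPeriodicSet M P)
    (g h : GaussianInt) : g + M * h ∈ P ↔ g ∈ P :=
  ⟨fun hg => by simpa using hP _ hg (-h), fun hg => hP g hg h⟩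

theorem IsPeriodicSet.ncard_inter_latticeBox {M : ℕ} {P : Set GaussianInt}
    (hP : IsPeriodicSet M P) (a b : ℤ) (k : ℕ) :
    (P ∩ latticeBox a b (k * M)).ncard = k ^ 2 * (P ∩ latticeBox 0 0 M).ncard := by
  classical
  rw [PaperFolding.ncard_inter_latticeBox, PaperFolding.ncard_inter_latticeBox]
  have h1 : ∀ x : ℤ, ∑ j ∈ Finset.range (k * M),
      (if (⟨x, b + j⟩ : GaussianInt) ∈ P then 1 else 0) =
        k * ∑ j ∈ Finset.range M, if (⟨x, j⟩ : GaussianInt) ∈ P then 1 else 0 := by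
    intro x
    refine sum_range_periodic (h := fun t : ℤ => if (⟨x, t⟩ : GaussianInt) ∈ P then 1 else 0) ?_ b k
    intro t
    have : (⟨x, t + M⟩ : GaussianInt) = ⟨x, t⟩ + M * ⟨0, 1⟩ := by ext <;> simp
    simp only [this, hP.add_mem_iff]
  simp only [h1]
  rw [sum_range_periodic
    (h := fun x : ℤ => k * ∑ j ∈ Finset.range M, if (⟨x, j⟩ : GaussianInt) ∈ P then 1 else 0) ?_ a k,
    ← Finset.mul_sum, ← mul_assoc, ← sq]
  · simp
  · intro x
    congr 1
    refine Finset.sum_congr rfl fun j _ => ?_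
    have : (⟨x + M, j⟩ : GaussianInt) = ⟨x, j⟩ + M * ⟨1, 0⟩ := by ext <;> simp
    simp only [this, hP.add_mem_iff]

/-- The Gaussian integers in a closed square with sides of length `L`. -/
def realBox (x y L : ℝ) : Set GaussianInt :=
  {g | x ≤ g.re ∧ g.re ≤ x + L ∧ y ≤ g.im ∧ g.im ≤ y + L}

theorem latticeBox_subset_realBox {x y L : ℝ} {n : ℕ} (hn : (n : ℝ) ≤ L) :
    latticeBox ⌈x⌉ ⌈y⌉ n ⊆ realBox x y L := by
  rintro g ⟨h1, h2, h3, h4⟩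
  have hx := Int.ceil_lt_add_one x
  have hy := Int.ceil_lt_add_one y
  have e2 : ((g.re + 1 : ℤ) : ℝ) ≤ ((⌈x⌉ + n : ℤ) : ℝ) := by exact_mod_cast h2
  have e4 : ((g.im + 1 : ℤ) : ℝ) ≤ ((⌈y⌉ + n : ℤ) : ℝ) := by exact_mod_cast h4
  push_cast at e2 e4
  exact ⟨Int.ceil_le.mp h1, by linarith, Int.ceil_le.mp h3, by linarith⟩

theorem realBox_subset_latticeBox {x y L : ℝ} {n : ℕ} (hn : L < n) :
    realBox x y L ⊆ latticeBox ⌈x⌉ ⌈y⌉ n := by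
  rintro g ⟨h1, h2, h3, h4⟩
  have hx := Int.le_ceil x
  have hy := Int.le_ceil y
  have e2 : ((g.re : ℤ) : ℝ) < ((⌈x⌉ + n : ℤ) : ℝ) := by push_cast; linarith
  have e4 : ((g.im : ℤ) : ℝ) < ((⌈y⌉ + n : ℤ) : ℝ) := by push_cast; linarith
  exact ⟨Int.ceil_le.mpr h1, Int.cast_lt.mp e2, Int.ceil_le.mpr h3, Int.cast_lt.mp e4⟩

theorem finite_realBox (x y L : ℝ) : (realBox x y L).Finite := by
  obtain ⟨n, hn⟩ := exists_nat_gt L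
  exact (finite_latticeBox _ _ n).subset (realBox_subset_latticeBox hn)

theorem IsPeriodicSet.le_ncard_inter_realBox {M : ℕ} (hM : 0 < M) {P : Set GaussianInt}
    (hP : IsPeriodicSet M P) (x y : ℝ) {L : ℝ} (hL : 0 ≤ L) :
    ((P ∩ latticeBox 0 0 M).ncard : ℝ) * ((L / M) ^ 2 - 2 * (L / M)) ≤
      ((P ∩ realBox x y L).ncard : ℝ) := by
  have hM' : (0 : ℝ) < M := by exact_mod_cast hM
  have ht : 0 ≤ L / M := by positivity
  have hk := Nat.floor_le ht
  have hk' := Nat.lt_floor_add_one (L / M)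
  have hsub : latticeBox ⌈x⌉ ⌈y⌉ (⌊L / M⌋₊ * M) ⊆ realBox x y L := by
    apply latticeBox_subset_realBox
    push_cast
    rwa [← le_div_iff₀ hM']
  have h1 := Set.ncard_le_ncard (Set.inter_subset_inter_right P hsub)
    ((finite_realBox x y L).inter_of_right P)
  rw [hP.ncard_inter_latticeBox] at h1
  have h2 : ((⌊L / M⌋₊ : ℝ)) ^ 2 * ((P ∩ latticeBox 0 0 M).ncard : ℝ) ≤
      ((P ∩ realBox x y L).ncard : ℝ) := by exact_mod_cast h1
  refine le_trans ?_ h2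
  rw [mul_comm]
  refine mul_le_mul_of_nonneg_right ?_ (Nat.cast_nonneg _)
  have h3 : (0 : ℝ) ≤ ⌊L / M⌋₊ := Nat.cast_nonneg _
  -- With `t = L / M`, the floor exceeds `t - 1`, whose square is at least `t ^ 2 - 2 * t` when `t ≥
  -- 1`; for `t ≤ 1` the bound is not positive.
  rcases le_total (L / M) 1 with h | h
  · nlinarith
  · nlinarith

theorem IsPeriodicSet.ncard_inter_realBox_le {M : ℕ} (hM : 0 < M) {P : Set GaussianInt}
    (hP : IsPeriodicSet M P) (x y : ℝ) {L : ℝ} (hL : 0 ≤ L) :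
    ((P ∩ realBox x y L).ncard : ℝ) ≤
      ((P ∩ latticeBox 0 0 M).ncard : ℝ) * (L / M + 1) ^ 2 := by
  have hM' : (0 : ℝ) < M := by exact_mod_cast hM
  have ht : 0 ≤ L / M := by positivity
  have hk := Nat.floor_le ht
  have hk' := Nat.lt_floor_add_one (L / M)
  have hsub : realBox x y L ⊆ latticeBox ⌈x⌉ ⌈y⌉ ((⌊L / M⌋₊ + 1) * M) := by
    apply realBox_subset_latticeBox
    push_cast
    rwa [← div_lt_iff₀ hM']
  have h1 := Set.ncard_le_ncard (Set.inter_subset_inter_right P hsub)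
    ((finite_latticeBox _ _ _).inter_of_right P)
  rw [hP.ncard_inter_latticeBox] at h1
  have h2 : ((P ∩ realBox x y L).ncard : ℝ) ≤
      ((⌊L / M⌋₊ + 1 : ℝ)) ^ 2 * ((P ∩ latticeBox 0 0 M).ncard : ℝ) := by exact_mod_cast h1
  refine h2.trans ?_
  rw [mul_comm]
  refine mul_le_mul_of_nonneg_left ?_ (Nat.cast_nonneg _)
  have h3 : (0 : ℝ) ≤ ⌊L / M⌋₊ := Nat.cast_nonneg _
  exact pow_le_pow_left₀ (by positivity) (by linarith) 2

theorem isPeriodicSet_congruent (M : ℕ) (c : GaussianInt) :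
    IsPeriodicSet M {u | (M : GaussianInt) ∣ u + c} := by
  intro g hg h
  have : g + M * h + c = g + c + M * h := by ring
  change (M : GaussianInt) ∣ g + M * h + c
  rw [this]
  exact dvd_add hg (dvd_mul_right _ _)

theorem ncard_congruent_le_one (M : ℕ) (c : GaussianInt) :
    ({u | (M : GaussianInt) ∣ u + c} ∩ latticeBox 0 0 M).ncard ≤ 1 := by
  rw [Set.ncard_le_one ((finite_latticeBox _ _ _).inter_of_right _)]
  rintro g ⟨hg, g1, g2, g3, g4⟩ h ⟨hh, h1, h2, h3, h4⟩
  have hd : (M : GaussianInt) ∣ g - h := by simpa using dvd_sub hg hh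
  have key : ∀ a b : ℤ, 0 ≤ a → a < M → 0 ≤ b → b < M → (M : ℤ) ∣ a - b → a = b := by
    intro a b a0 a1 b0 b1 hab
    have := Int.eq_zero_of_abs_lt_dvd hab (by rw [abs_lt]; omega)
    omega
  have hd' : ((M : ℤ) : GaussianInt) ∣ g - h := by simpa using hd
  rw [Zsqrtd.intCast_dvd] at hd'
  ext
  · exact key _ _ g1 (by simpa using g2) h1 (by simpa using h2) (by simpa using hd'.1)
  · exact key _ _ g3 (by simpa using g4) h3 (by simpa using h4) (by simpa using hd'.2)

/-! ### Densities from periodic approximations -/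

/-- A counting function on squares which is approximated by periodic ones has a density. -/
theorem exists_uniform_density {ι : Type*} [Nonempty ι] {f : ℝ → ι → ℝ} {δ κ : ℕ → ℝ}
    (hκ : Filter.Tendsto κ Filter.atTop (nhds 0))
    (h : ∀ n, ∃ K : ℝ, ∀ s : ℝ, 1 ≤ s → ∀ i, δ n * s ^ 2 - K * s ≤ f s i ∧
      f s i ≤ (δ n + κ n) * s ^ 2 + K * s) {n₀ : ℕ} (hpos : 0 < δ n₀) :
    ∃ d : ℝ, (∀ n, δ n ≤ d) ∧ ∀ ε : ℝ, 0 < ε → ∃ r : ℝ, 0 < r ∧ ∀ s : ℝ, r ≤ s → ∀ i,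
      s ^ 2 * d * (1 - ε) < f s i ∧ f s i < s ^ 2 * d * (1 + ε) := by
  choose K hK using h
  -- Compare the lower bound at `n` with the upper bound at `m` on a square so large that the linear
  -- errors are negligible. The supremum of `δ` then lies in all the intervals `[δ m, δ m + κ m]`.
  have hle : ∀ n m, δ n ≤ δ m + κ m := by
    intro n m
    by_contra! hlt
    obtain ⟨s, hs⟩ := exists_nat_gt (max 1 ((K n + K m) / (δ n - (δ m + κ m))))
    obtain ⟨i⟩ := ‹Nonempty ι›
    have hs1 : (1 : ℝ) < s := (le_max_left _ _).trans_lt hs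
    have hs2 := (le_max_right _ _).trans_lt hs
    rw [div_lt_iff₀ (by linarith)] at hs2
    have e1 := (hK n s hs1.le i).1
    have e2 := (hK m s hs1.le i).2
    nlinarith
  have hbdd : BddAbove (Set.range δ) := ⟨δ 0 + κ 0, by rintro _ ⟨n, rfl⟩; exact hle n 0⟩
  have hd1 : ∀ n, δ n ≤ ⨆ n, δ n := fun n => le_ciSup hbdd n
  have hd2 : ∀ m, ⨆ n, δ n ≤ δ m + κ m := fun m => ciSup_le fun n => hle n m
  generalize (⨆ n, δ n) = d at hd1 hd2
  have hd : 0 < d := hpos.trans_le (hd1 n₀)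
  refine ⟨d, hd1, fun ε hε => ?_⟩
  obtain ⟨m, hm⟩ := (hκ.eventually (gt_mem_nhds (show 0 < d * ε / 2 by positivity))).exists
  refine ⟨max 1 (2 * |K m| / (d * ε) + 1), by positivity, fun s hs i => ?_⟩
  have hs1 : 1 ≤ s := (le_max_left _ _).trans hs
  have hs2 : 2 * |K m| / (d * ε) < s := by linarith [(le_max_right _ _).trans hs]
  rw [div_lt_iff₀ (by positivity)] at hs2
  obtain ⟨e1, e2⟩ := hK m s hs1 i
  have hKs : K m * s < d * ε / 2 * s ^ 2 := by
    have := le_abs_self (K m)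
    nlinarith
  have g1 := hd1 m
  have g2 := hd2 m
  have hsq : 0 < s ^ 2 := by positivity
  constructor
  · nlinarith
  · nlinarith

/-! ### Copies in a square as sets of shifts -/

theorem mem_square_iff {s : ℝ} {z p : ℂ} :
    p ∈ square s z ↔ z.re ≤ p.re ∧ p.re ≤ z.re + s ∧ z.im ≤ p.im ∧ p.im ≤ z.im + s := by
  constructor
  · rintro ⟨x, ⟨x0, x1⟩, y, ⟨y0, y1⟩, rfl⟩
    simp
    refine ⟨x0, x1, y0, y1⟩
  · rintro ⟨h1, h2, h3, h4⟩
    refine ⟨p.re - z.re, ⟨by linarith, by linarith⟩, p.im - z.im, ⟨by linarith, by linarith⟩, ?_⟩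
    apply Complex.ext <;> simp

theorem convex_square (s : ℝ) (z : ℂ) : Convex ℝ (square s z) := by
  have h : square s z = Complex.reLm ⁻¹' Set.Icc z.re (z.re + s) ∩
      Complex.imLm ⁻¹' Set.Icc z.im (z.im + s) := by
    ext p
    rw [mem_square_iff]
    simp [and_assoc]
  rw [h]
  exact ((convex_Icc _ _).linear_preimage _).inter ((convex_Icc _ _).linear_preimage _)

theorem supportOf_subset_square_iff {B : Set Curve} {s : ℝ} {z : ℂ} :
    supportOf B ⊆ square s z ↔ ∀ v ∈ verticesOf B, GaussianInt.toComplex v ∈ square s z := by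
  constructor
  · exact fun h v hv => h (toComplex_mem_supportOf hv)
  · rintro h p ⟨A, hA, hp⟩
    exact (convex_square s z).segment_subset (h _ ⟨A, hA, Or.inl rfl⟩)
      (h _ ⟨A, hA, Or.inr rfl⟩) hp

theorem ncard_copiesIn {B : Set Curve} (C : Set Curve) (hB : B.Nonempty) (hbdd : IsBoundedSystem B)
    (s : ℝ) (z : ℂ) : (copiesIn B C s z).ncard =
      {u | Below (translateSet u B) C ∧
        ∀ w ∈ verticesOf B, GaussianInt.toComplex (u + w) ∈ square s z}.ncard := by
  rw [← Set.ncard_image_of_injective (f := fun u => translateSet u B) _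
    fun u u' h => translateSet_inj hB hbdd h]
  congr 1
  ext F
  constructor
  · rintro ⟨h1, h2, h3⟩
    obtain ⟨u, rfl⟩ := isCopy_iff.mp h2
    refine ⟨u, ⟨h1, fun w hw => ?_⟩, rfl⟩
    exact supportOf_subset_square_iff.mp h3 _ (verticesOf_translateSet.mpr ⟨w, hw, rfl⟩)
  · rintro ⟨u, ⟨h1, h2⟩, rfl⟩
    refine ⟨h1, isCopy_iff.mpr ⟨u, rfl⟩, supportOf_subset_square_iff.mpr ?_⟩
    intro v hv
    obtain ⟨w, hw, rfl⟩ := verticesOf_translateSet.mp hv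
    exact h2 w hw

/-! ### Good shifts, counting bounds and the theorem -/

theorem oneAddI_pow_two_mul (n : ℕ) :
    oneAddI ^ (2 * n) = ((2 ^ n : ℕ) : GaussianInt) * (iUnit ^ n : GaussianIntˣ) := by
  have h : oneAddI ^ 2 = 2 * ((iUnit : GaussianIntˣ) : GaussianInt) := by
    ext <;> simp [pow_two]
  rw [pow_mul, h, mul_pow]
  push_cast
  rfl

theorem two_pow_dvd_oneAddI_pow (n : ℕ) :
    ((2 ^ n : ℕ) : GaussianInt) ∣ oneAddI ^ (2 * n + 1) := by
  rw [pow_succ, oneAddI_pow_two_mul, mul_assoc]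
  exact dvd_mul_right _ _

theorem oneAddI_pow_dvd_two_pow (n : ℕ) :
    oneAddI ^ (2 * n) ∣ ((2 ^ n : ℕ) : GaussianInt) := by
  refine ⟨((iUnit ^ n)⁻¹ : GaussianIntˣ), ?_⟩
  rw [oneAddI_pow_two_mul, mul_assoc, Units.mul_inv, mul_one]

/-- The translations which map `B` to a copy in `C` without vertex of level `N`. -/
def goodShifts (B C : Set Curve) (N : ℕ) (z : GaussianInt) : Set GaussianInt :=
  {u | Below (translateSet u B) C ∧ ∀ w ∈ verticesOf B, ¬ oneAddI ^ N ∣ u + w - z}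

section Main

variable {B C : Set Curve}

theorem IsCovering.isPeriodicSet_goodShifts (hC : IsCovering C)
    (hfold : ∀ c ∈ C, c.IsCompleteFolding) {n : ℕ} {z : GaussianInt} {s : ℕ → ℤˣ}
    (hz : ∀ c ∈ C, ∀ a, c.IsAssociatedTo a → c.IsHierarchical a (2 * n + 1) z s)
    (hbdd : IsBoundedSystem B) :
    IsPeriodicSet (2 ^ (n + 1)) (goodShifts B C (2 * n + 1) z) := by
  rintro u ⟨h1, h2⟩ g
  have hg : oneAddI ^ (2 * n + 1 + 1) ∣ ((2 ^ (n + 1) : ℕ) : GaussianInt) * g :=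
    (oneAddI_pow_dvd_two_pow (n + 1)).trans (dvd_mul_right _ _)
  have hset : translateSet (u + ((2 ^ (n + 1) : ℕ) : GaussianInt) * g) B =
      translateSet (((2 ^ (n + 1) : ℕ) : GaussianInt) * g) (translateSet u B) := by
    rw [translateSet_translateSet, add_comm]
  constructor
  · rw [hset]
    refine hC.below_translateSet hfold hz hg h1 (hset ▸ hC.translateSet_ne hbdd _) ?_
    intro v hv
    obtain ⟨w, hw, rfl⟩ := verticesOf_translateSet.mp hv
    exact h2 w hw
  · intro w hw hd
    refine h2 w hw ?_
    have := dvd_sub hd ((pow_dvd_pow _ (by omega)).trans hg)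
    convert this using 1
    ring

theorem IsCovering.exists_count_bounds (hC : IsCovering C)
    (hfold : ∀ c ∈ C, c.IsCompleteFolding) {n : ℕ} {z : GaussianInt} {s : ℕ → ℤˣ}
    (hz : ∀ c ∈ C, ∀ a, c.IsAssociatedTo a → c.IsHierarchical a (2 * n + 1) z s)
    (hB : B.Nonempty) (hbdd : IsBoundedSystem B) :
    ∃ K : ℝ, ∀ L : ℝ, 1 ≤ L → ∀ ζ : ℂ,
      ((goodShifts B C (2 * n + 1) z ∩ latticeBox 0 0 (2 ^ (n + 1))).ncard : ℝ) /
          (2 ^ (n + 1)) ^ 2 * L ^ 2 - K * L ≤ ((copiesIn B C L ζ).ncard : ℝ) ∧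
      ((copiesIn B C L ζ).ncard : ℝ) ≤
        (((goodShifts B C (2 * n + 1) z ∩ latticeBox 0 0 (2 ^ (n + 1))).ncard : ℝ) /
          (2 ^ (n + 1)) ^ 2 + ((verticesOf B).ncard : ℝ) / (2 ^ n) ^ 2) * L ^ 2 + K * L := by
  have hper := hC.isPeriodicSet_goodShifts hfold hz hbdd
  have hfin := finite_verticesOf hbdd
  obtain ⟨w₀, hw₀⟩ := nonempty_verticesOf hB
  -- `R` bounds the extent of `B` seen from `w₀`: shifts in a square shrunk by `R` on each side keep
  -- every vertex inside, while `w₀` alone confines the shifts to a square of side `L`.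
  obtain ⟨R, hR0, hR⟩ : ∃ R : ℝ, 0 ≤ R ∧ ∀ w ∈ verticesOf B,
      |((w.re - w₀.re : ℤ) : ℝ)| ≤ R ∧ |((w.im - w₀.im : ℤ) : ℝ)| ≤ R := by
    obtain ⟨R, hR⟩ := (hfin.image fun w =>
      max |((w.re - w₀.re : ℤ) : ℝ)| |((w.im - w₀.im : ℤ) : ℝ)|).bddAbove
    refine ⟨R, ?_, fun w hw => max_le_iff.mp (hR ⟨w, hw, rfl⟩)⟩
    exact (abs_nonneg _).trans (max_le_iff.mp (hR ⟨w₀, hw₀, rfl⟩)).1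
  set P := goodShifts B C (2 * n + 1) z with hP
  set p : ℝ := ((P ∩ latticeBox 0 0 (2 ^ (n + 1))).ncard : ℝ) with hp
  set W : ℝ := ((verticesOf B).ncard : ℝ) with hW
  have hp0 : 0 ≤ p := Nat.cast_nonneg _
  have hW0 : 0 ≤ W := Nat.cast_nonneg _
  have hM : (1 : ℝ) ≤ 2 ^ (n + 1) := one_le_pow₀ (by norm_num)
  have hm : (1 : ℝ) ≤ 2 ^ n := one_le_pow₀ (by norm_num)
  have hMpos : (0 : ℝ) < 2 ^ (n + 1) := by positivity
  have hmpos : (0 : ℝ) < 2 ^ n := by positivity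
  refine ⟨p * (4 * R + 3) + 3 * W, fun L hL ζ => ?_⟩
  rw [ncard_copiesIn C hB hbdd]
  set S := {u | Below (translateSet u B) C ∧
    ∀ w ∈ verticesOf B, GaussianInt.toComplex (u + w) ∈ square L ζ} with hS
  have hmem : ∀ u w : GaussianInt, GaussianInt.toComplex (u + w) ∈ square L ζ ↔
      ζ.re ≤ u.re + w.re ∧ (u.re + w.re : ℝ) ≤ ζ.re + L ∧
      ζ.im ≤ u.im + w.im ∧ (u.im + w.im : ℝ) ≤ ζ.im + L := by
    intro u w
    rw [mem_square_iff, ← GaussianInt.intCast_re, ← GaussianInt.intCast_im]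
    simp
  have hSbox : S ⊆ realBox (ζ.re - w₀.re) (ζ.im - w₀.im) L := by
    rintro u ⟨-, hu⟩
    obtain ⟨h1, h2, h3, h4⟩ := (hmem u w₀).mp (hu w₀ hw₀)
    exact ⟨by linarith, by linarith, by linarith, by linarith⟩
  have hSfin : S.Finite := (finite_realBox _ _ _).subset hSbox
  have hdiv : ∀ M : ℝ, 1 ≤ M → L / M ≤ L := fun M hM => div_le_self (by linarith) hM
  constructor
  · rcases le_total (2 * R) L with hLR | hLR
    · have h1 := hper.le_ncard_inter_realBox (by positivity) (ζ.re - w₀.re + R)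
        (ζ.im - w₀.im + R) (sub_nonneg.mpr hLR)
      have hsub : P ∩ realBox (ζ.re - w₀.re + R) (ζ.im - w₀.im + R) (L - 2 * R) ⊆ S := by
        rintro u ⟨⟨hu, -⟩, g1, g2, g3, g4⟩
        refine ⟨hu, fun w hw => (hmem u w).mpr ?_⟩
        obtain ⟨b1, b2⟩ := hR w hw
        rw [abs_le] at b1 b2
        push_cast at b1 b2
        exact ⟨by linarith, by linarith, by linarith, by linarith⟩
      have h2 : ((P ∩ realBox (ζ.re - w₀.re + R) (ζ.im - w₀.im + R) (L - 2 * R)).ncard : ℝ) ≤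
          (S.ncard : ℝ) := by exact_mod_cast Set.ncard_le_ncard hsub hSfin
      refine le_trans ?_ (h1.trans h2)
      push_cast
      rw [← hp]
      have e1 : ((L - 2 * R) / 2 ^ (n + 1)) ^ 2 ≥ L ^ 2 / (2 ^ (n + 1)) ^ 2 - 4 * R * L := by
        rw [div_pow, ge_iff_le, sub_le_iff_le_add, div_le_iff₀ (by positivity), add_mul,
          div_mul_cancel₀ _ (by positivity)]
        have : 4 * R * L ≤ 4 * R * L * (2 ^ (n + 1)) ^ 2 :=
          le_mul_of_one_le_right (by positivity) (one_le_pow₀ hM)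
        nlinarith
      have e2 : (L - 2 * R) / 2 ^ (n + 1) ≤ L :=
        (div_le_self (by linarith) hM).trans (by linarith)
      have e3 : L ^ 2 / (2 ^ (n + 1)) ^ 2 - (4 * R + 3) * L ≤
          ((L - 2 * R) / 2 ^ (n + 1)) ^ 2 - 2 * ((L - 2 * R) / 2 ^ (n + 1)) := by linarith
      have e4 := mul_le_mul_of_nonneg_left e3 hp0
      have e5 : 0 ≤ W * L := by positivity
      calc p / (2 ^ (n + 1)) ^ 2 * L ^ 2 - (p * (4 * R + 3) + 3 * W) * L
          = p * (L ^ 2 / (2 ^ (n + 1)) ^ 2 - (4 * R + 3) * L) - 3 * (W * L) := by ring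
        _ ≤ _ := by linarith
    -- The shrunk square may be empty, but then the linear error already makes the lower bound
    -- nonpositive.
    · have e1 : L ^ 2 / (2 ^ (n + 1)) ^ 2 ≤ (4 * R + 3) * L := by
        refine (div_le_self (by positivity) (one_le_pow₀ hM)).trans ?_
        nlinarith
      have e4 := mul_le_mul_of_nonneg_left e1 hp0
      have e5 : 0 ≤ W * L := by positivity
      have e6 : (0 : ℝ) ≤ S.ncard := Nat.cast_nonneg _
      calc p / (2 ^ (n + 1)) ^ 2 * L ^ 2 - (p * (4 * R + 3) + 3 * W) * L
          = p * (L ^ 2 / (2 ^ (n + 1)) ^ 2) - p * ((4 * R + 3) * L) - 3 * (W * L) := by ring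
        _ ≤ _ := by linarith
  · set Q : GaussianInt → Set GaussianInt :=
      fun w => {u | ((2 ^ n : ℕ) : GaussianInt) ∣ u + (w - z)} with hQ
    set bx := realBox (ζ.re - w₀.re) (ζ.im - w₀.im) L with hbx
    have hbxfin : bx.Finite := finite_realBox _ _ _
    -- A shift that is not good sends some vertex `w` of `B` to level `2 * n + 1`, hence lies in a
    -- single class modulo `2 ^ n` determined by `w`.
    have hsub : S ⊆ (P ∩ bx) ∪ ⋃ w ∈ hfin.toFinset, (Q w ∩ bx) := by
      intro u hu
      by_cases huP : u ∈ P
      · exact Or.inl ⟨huP, hSbox hu⟩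
      · right
        have : ∃ w ∈ verticesOf B, oneAddI ^ (2 * n + 1) ∣ u + w - z := by
          by_contra hcon
          push Not at hcon
          exact huP ⟨hu.1, hcon⟩
        obtain ⟨w, hw, hd⟩ := this
        simp only [Set.mem_iUnion]
        refine ⟨w, by simpa using hw, ?_, hSbox hu⟩
        rw [add_sub_assoc] at hd
        exact (two_pow_dvd_oneAddI_pow n).trans hd
    have h1 : S.ncard ≤ (P ∩ bx).ncard + ∑ w ∈ hfin.toFinset, (Q w ∩ bx).ncard := by
      refine (Set.ncard_le_ncard hsub ?_).trans ((Set.ncard_union_le _ _).trans ?_)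
      · exact (hbxfin.inter_of_right _).union
          (Set.Finite.biUnion hfin.toFinset.finite_toSet fun w _ => hbxfin.inter_of_right _)
      · gcongr
        exact Finset.set_ncard_biUnion_le _ _
    have h2 := hper.ncard_inter_realBox_le (by positivity) (ζ.re - w₀.re) (ζ.im - w₀.im)
      (L := L) (by linarith)
    have h3 : ∀ w, ((Q w ∩ bx).ncard : ℝ) ≤ (L / 2 ^ n + 1) ^ 2 := by
      intro w
      have := (isPeriodicSet_congruent (2 ^ n) (w - z)).ncard_inter_realBox_le (by positivity)
        (ζ.re - w₀.re) (ζ.im - w₀.im) (L := L) (by linarith)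
      refine this.trans ?_
      push_cast
      refine mul_le_of_le_one_left (by positivity) ?_
      exact_mod_cast ncard_congruent_le_one (2 ^ n) (w - z)
    have h4 : ∑ w ∈ hfin.toFinset, ((Q w ∩ bx).ncard : ℝ) ≤ W * (L / 2 ^ n + 1) ^ 2 := by
      refine (Finset.sum_le_card_nsmul _ _ _ fun w _ => h3 w).trans ?_
      rw [nsmul_eq_mul, hW, Set.ncard_eq_toFinset_card _ hfin]
    have h5 : (S.ncard : ℝ) ≤ (P ∩ bx).ncard + ∑ w ∈ hfin.toFinset, ((Q w ∩ bx).ncard : ℝ) := by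
      exact_mod_cast h1
    push_cast at h2
    rw [← hp] at h2
    have key : ∀ M : ℝ, 1 ≤ M → (L / M + 1) ^ 2 ≤ L ^ 2 / M ^ 2 + 3 * L := by
      intro M hM
      have := hdiv M hM
      rw [← div_pow]
      nlinarith
    have e1 := mul_le_mul_of_nonneg_left (key _ hM) hp0
    have e2 := mul_le_mul_of_nonneg_left (key _ hm) hW0
    have e3 : 0 ≤ p * R * L := by positivity
    calc (S.ncard : ℝ) ≤ p * (L ^ 2 / (2 ^ (n + 1)) ^ 2 + 3 * L) +
          W * (L ^ 2 / (2 ^ n) ^ 2 + 3 * L) := by linarith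
      _ ≤ (p / (2 ^ (n + 1)) ^ 2 + W / (2 ^ n) ^ 2) * L ^ 2 + (p * 3 + 3 * W) * L +
          4 * (p * R * L) := by
        have : 0 ≤ 4 * (p * R * L) := by linarith
        have e : p * (L ^ 2 / (2 ^ (n + 1)) ^ 2 + 3 * L) + W * (L ^ 2 / (2 ^ n) ^ 2 + 3 * L) =
          (p / (2 ^ (n + 1)) ^ 2 + W / (2 ^ n) ^ 2) * L ^ 2 + (p * 3 + 3 * W) * L := by ring
        linarith
      _ = _ := by ring

theorem IsCovering.mem_vertexE_iff (hC : IsCovering C)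
    (hfold : ∀ c ∈ C, c.IsCompleteFolding) {N : ℕ} {z : GaussianInt} {s : ℕ → ℤˣ}
    (hz : ∀ c ∈ C, ∀ a, c.IsAssociatedTo a → c.IsHierarchical a N z s) (v : GaussianInt) :
    v ∈ vertexE C N ↔ oneAddI ^ N ∣ v - z := by
  constructor
  · rintro ⟨c, hc, a, ha, k, hk, rfl⟩
    rw [← c.segAt_coe]
    exact ((hz c hc a ha).mem_seqE_iff N le_rfl k).mp hk
  · intro hd
    obtain ⟨c, hc, k, hk⟩ : ∃ c ∈ C, ∃ k, (c.segAt k).term = v := by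
      obtain ⟨c, hc, k, hk⟩ := hC.exists_edge_eq ⟨v, 1⟩
      rcases (Seg.edge_eq_iff _ _).mp hk with h | ⟨h1, h2⟩
      · refine ⟨c, hc, k - 1, ?_⟩
        rw [(hC.complete c hc).term_eq, sub_add_cancel, h]
      · refine ⟨c, hc, k, ?_⟩
        rw [Seg.term, h1, h2, Seg.term]
        simp
    obtain ⟨hcc, a, -, ha⟩ := hfold c hc
    refine ⟨c, hc, a, ha, ⟨k, hcc.mem k⟩, ?_, ?_⟩
    · rw [(hz c hc a ha).mem_seqE_iff N le_rfl k, hk]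
      exact hd
    · rw [← hk, c.segAt_eq (hcc.mem k)]

theorem norm_oneAddI_pow (N : ℕ) : ‖GaussianInt.toComplex (oneAddI ^ N)‖ ^ 2 = 2 ^ N := by
  rw [map_pow, norm_pow, ← pow_mul, mul_comm, pow_mul]
  congr 1
  rw [← Complex.normSq_eq_norm_sq, Complex.normSq_apply, ← GaussianInt.intCast_re,
    ← GaussianInt.intCast_im]
  norm_num

theorem one_le_norm_toComplex {g : GaussianInt} (hg : g ≠ 0) : 1 ≤ ‖GaussianInt.toComplex g‖ := by
  have h : 1 ≤ g.re ^ 2 + g.im ^ 2 := by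
    by_contra! hlt
    have h1 : g.re = 0 := by nlinarith [sq_nonneg g.re, sq_nonneg g.im]
    have h2 : g.im = 0 := by nlinarith [sq_nonneg g.re, sq_nonneg g.im]
    exact hg (Zsqrtd.ext h1 h2)
  have h' : (1 : ℝ) ≤ (g.re : ℝ) ^ 2 + (g.im : ℝ) ^ 2 := by exact_mod_cast h
  rw [← one_le_sq_iff₀ (norm_nonneg _), ← Complex.normSq_eq_norm_sq, Complex.normSq_apply,
    ← GaussianInt.intCast_re, ← GaussianInt.intCast_im]
  linarith

theorem IsCovering.exists_copy_disjoint (hC : IsCovering C)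
    (hfold : ∀ c ∈ C, c.IsCompleteFolding) (hloc : LocalIsomorphismProperty C)
    (hB : IsCurveSystem B) (hbdd : IsBoundedSystem B) (hBC : Below B C) :
    ∃ (n : ℕ) (A : Set Curve), Below A C ∧ IsCopy A B ∧
      Disjoint (verticesOf A) (vertexE C (2 * n + 1)) := by
  obtain ⟨r, hr⟩ := hloc B hB hbdd hBC
  obtain ⟨F, hF, hFB, hFr⟩ := hr 0
  -- This ball is disjoint from the first one, so vertices `v` of `F` and `w` of `G` are distinct,
  -- at distance at most `4 * |r| + 1`. If both have level `2 * n + 1`, then `w - v` is a nonzero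
  -- multiple of `(1 + i) ^ (2 * n + 1)`, which is too long.
  obtain ⟨G, hG, hGB, hGr⟩ := hr ((2 * |r| + 1 : ℝ) : ℂ)
  obtain ⟨n, hn⟩ := exists_nat_gt ((4 * |r| + 1) ^ 2)
  obtain ⟨z, s, hz⟩ := hC.exists_isHierarchical hfold hloc (2 * n + 1)
  by_contra! hcon
  obtain ⟨v, hv, hvE⟩ := Set.not_disjoint_iff.mp (hcon n F hF hFB)
  obtain ⟨w, hw, hwE⟩ := Set.not_disjoint_iff.mp (hcon n G hG hGB)
  rw [hC.mem_vertexE_iff hfold hz] at hvE hwE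
  have hd : oneAddI ^ (2 * n + 1) ∣ w - v := by simpa using dvd_sub hwE hvE
  have h1 := hFr (toComplex_mem_supportOf hv)
  have h2 := hGr (toComplex_mem_supportOf hw)
  rw [mem_closedBall_iff_norm] at h1 h2
  have hr1 := le_abs_self r
  have hr2 := abs_nonneg r
  have hn0 : ‖((2 * |r| + 1 : ℝ) : ℂ)‖ = 2 * |r| + 1 := by
    rw [Complex.norm_real, Real.norm_of_nonneg (by positivity)]
  rw [sub_zero] at h1
  have hne : w - v ≠ 0 := by
    intro h0
    rw [sub_eq_zero] at h0
    subst h0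
    have := norm_sub_norm_le (((2 * |r| + 1 : ℝ) : ℂ)) (GaussianInt.toComplex w)
    rw [norm_sub_rev] at h2
    linarith
  have hle : ‖GaussianInt.toComplex (w - v)‖ ≤ 4 * |r| + 1 := by
    rw [map_sub]
    have e1 := norm_sub_le (GaussianInt.toComplex w) (GaussianInt.toComplex v)
    have e2 := norm_sub_norm_le (GaussianInt.toComplex w) (((2 * |r| + 1 : ℝ) : ℂ))
    linarith
  obtain ⟨g, hg⟩ := hd
  have hg0 : g ≠ 0 := by rintro rfl; exact hne (by simpa using hg)
  rw [hg, map_mul, norm_mul] at hle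
  have h3 := one_le_norm_toComplex hg0
  have h4 := norm_oneAddI_pow (2 * n + 1)
  have h5 : ‖GaussianInt.toComplex (oneAddI ^ (2 * n + 1))‖ ≤ 4 * |r| + 1 :=
    (le_mul_of_one_le_right (norm_nonneg _) h3).trans hle
  have h6 := pow_le_pow_left₀ (norm_nonneg _) h5 2
  rw [h4] at h6
  have h7 : ((2 * n + 1 : ℕ) : ℝ) < 2 ^ (2 * n + 1) := by exact_mod_cast Nat.lt_two_pow_self
  push_cast at h7
  have h8 : (0 : ℝ) ≤ n := Nat.cast_nonneg n
  linarith

theorem IsPeriodicSet.one_le_ncard {M : ℕ} (hM : 0 < M) {P : Set GaussianInt}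
    (hP : IsPeriodicSet M P) (hne : P.Nonempty) : 1 ≤ (P ∩ latticeBox 0 0 M).ncard := by
  obtain ⟨u, hu⟩ := hne
  rw [Nat.one_le_iff_ne_zero, ← Nat.pos_iff_ne_zero,
    Set.ncard_pos ((finite_latticeBox _ _ _).inter_of_right _)]
  have hM' : (0 : ℤ) < M := by exact_mod_cast hM
  refine ⟨u + M * ⟨-(u.re / M), -(u.im / M)⟩, hP u hu _, ?_⟩
  have e1 : u.re + M * -(u.re / M) = u.re % M := by rw [Int.emod_def]; ring
  have e2 : u.im + M * -(u.im / M) = u.im % M := by rw [Int.emod_def]; ring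
  have g : u + M * ⟨-(u.re / M), -(u.im / M)⟩ = (⟨u.re % M, u.im % M⟩ : GaussianInt) := by
    ext
    · simpa using e1
    · simpa using e2
  rw [g]
  exact ⟨Int.emod_nonneg _ hM'.ne', by simpa using Int.emod_lt_of_pos _ hM',
    Int.emod_nonneg _ hM'.ne', by simpa using Int.emod_lt_of_pos _ hM'⟩

theorem HasDensity.le {d d' : ℝ} (h : HasDensity B C d) (h' : HasDensity B C d') : d ≤ d' := by
  by_contra! hlt
  have hd : 0 < d := h'.1.trans_lt hlt
  obtain ⟨ε, hε, hε'⟩ : ∃ ε : ℝ, 0 < ε ∧ d' * (1 + ε) ≤ d * (1 - ε) := by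
    -- With this `ε`, `d * (1 - ε)` is the midpoint of `d'` and `d`, and `d' * (1 + ε)` does not
    -- exceed it.
    refine ⟨(d - d') / (2 * d), by have := sub_pos.mpr hlt; positivity, ?_⟩
    have e : (d - d') / (2 * d) * d = (d - d') / 2 := by field_simp
    have : (d - d') / (2 * d) * d' ≤ (d - d') / (2 * d) * d :=
      mul_le_mul_of_nonneg_left hlt.le (by have := sub_pos.mpr hlt; positivity)
    linarith
  obtain ⟨r, hr, H⟩ := h.2 ε hε
  obtain ⟨r', hr', H'⟩ := h'.2 ε hε
  have h1 := (H (max r r') (le_max_left _ _) 0).1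
  have h2 := (H' (max r r') (le_max_right _ _) 0).2
  have h3 := mul_le_mul_of_nonneg_left hε' (sq_nonneg (max r r'))
  linarith

end Main

end PaperFolding

open PaperFolding
theorem theorem3 (C : Set Curve) (hC : IsCovering C)
    (hfold : ∀ c ∈ C, c.IsCompleteFolding)
    (hloc : LocalIsomorphismProperty C)
    (B : Set Curve) (hB : IsCurveSystem B) (hne : B.Nonempty)
    (hbdd : IsBoundedSystem B) (hBC : Below B C) :
    ∃ d : ℝ, 0 < d ∧ HasDensity B C d ∧ (∀ d' : ℝ, HasDensity B C d' → d' = d) ∧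
      ∃ n : ℕ,
        IsLeast {n : ℕ | ∃ A : Set Curve, Below A C ∧ IsCopy A B ∧
          Disjoint (verticesOf A) (vertexE C (2 * n + 1))} n ∧
        1 / 2 ^ (2 * n + 2) ≤ d := by
  classical
  choose z s hz using fun n : ℕ => hC.exists_isHierarchical hfold hloc (2 * n + 1)
  have hex := hC.exists_copy_disjoint hfold hloc hB hbdd hBC
  have hδ : ∀ n, (∃ A : Set Curve, Below A C ∧ IsCopy A B ∧
      Disjoint (verticesOf A) (vertexE C (2 * n + 1))) → (1 : ℝ) / 2 ^ (2 * n + 2) ≤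
        ((goodShifts B C (2 * n + 1) (z n) ∩ latticeBox 0 0 (2 ^ (n + 1))).ncard : ℝ) /
          (2 ^ (n + 1)) ^ 2 := by
    rintro n ⟨A, hA, hAB, hdisj⟩
    obtain ⟨u, rfl⟩ := isCopy_iff.mp hAB
    -- A single copy that avoids `E_{2n+1}` gives, by periodicity, a good shift in the period square
    -- of area `2 ^ (2 * n + 2)`.
    have h1 := (hC.isPeriodicSet_goodShifts hfold (hz n) hbdd).one_le_ncard (by positivity)
      ⟨u, hA, fun w hw hd => Set.disjoint_left.mp hdisj
        (verticesOf_translateSet.mpr ⟨w, hw, rfl⟩)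
        ((hC.mem_vertexE_iff hfold (hz n) _).mpr hd)⟩
    rw [← pow_mul, show (n + 1) * 2 = 2 * n + 2 by ring]
    gcongr
    exact_mod_cast h1
  have hκ : Filter.Tendsto (fun n : ℕ => ((verticesOf B).ncard : ℝ) / (2 ^ n) ^ 2) Filter.atTop
      (nhds 0) := by
    have : Filter.Tendsto (fun n : ℕ => (((2 : ℝ) ^ 2)) ^ n) Filter.atTop Filter.atTop :=
      tendsto_pow_atTop_atTop_of_one_lt (by norm_num)
    simp_rw [← pow_mul, mul_comm _ 2, pow_mul]
    exact this.const_div_atTop _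
  obtain ⟨d, hd, hdens⟩ := exists_uniform_density hκ
    (fun n => hC.exists_count_bounds hfold (hz n) hne hbdd)
    ((by positivity : (0 : ℝ) < 1 / 2 ^ (2 * Nat.find hex + 2)).trans_le
      (hδ _ (Nat.find_spec hex)))
  have hle : (1 : ℝ) / 2 ^ (2 * Nat.find hex + 2) ≤ d :=
    (hδ _ (Nat.find_spec hex)).trans (hd _)
  have hpos : 0 < d := lt_of_lt_of_le (by positivity) hle
  have hD : HasDensity B C d := ⟨hpos.le, hdens⟩
  exact ⟨d, hpos, hD, fun d' h' => le_antisymm (h'.le hD) (hD.le h'), Nat.find hex,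
    ⟨Nat.find_spec hex, fun m hm => Nat.find_min' hex hm⟩, hle⟩
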